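/- We work over $\mathbb{C}$. Let $\nu_3(L)$ denote the vector of all $56$ cubic monomials in $L=(L_0:\dots:L_5)$, and for a $6\times 6$ matrix $B$ let $\nu_3^{5,5}(B)$ be the $56\times 56$ matrix with $\nu_3(BL)=\nu_3^{5,5}(B)\,\nu_3(L)$ for all $L$. For a $4\times4$ matrix $M$ let $\wedge^2M$ be the $6\times 6$ matrix of its $2\times 2$ minors, with index pairs in the order $12,13,14,23,24,34$; Plücker vectors $\mathbf{pl}(X,Y)=(X_iY_j-X_jY_i)_{ij}$ of lines in $\mathbb{P}^3$ use the same order. Let $\Sigma$ be the $6\times6$ antidiagonal matrix with antidiagonal entries $1,-1,1,1,-1,1$. Let $\omega^{\mathrm{tw}}\in\mathbb{C}^{56}$ be the vector with $$(\omega^{\mathrm{tw}})^\top\nu_3(L)=-L_3^3-L_3^2L_2+2L_4L_3L_1-L_5L_1^2-L_4^2L_0+L_5L_3L_0+L_5L_2L_0 .$$ A twisted cubic is the image $A\cdot C$ of $C=\{(s^3:s^2t:st^2:t^3)\}\subset\mathbb{P}^3$ under an invertible $4\times4$ matrix $A$. It is represented in $\mathbb{P}^{55}$ by the vector $\beta_A=\nu_3^{5,5}\big((\wedge^2A)^{-1}\big)^\top\omega^{\mathrm{tw}}$;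 let $\mathrm{Ch}_{\mathrm{tw}}(\mathbb{P}^3)\subseteq\mathbb{P}^{55}$ be the Zariski closure of the set of all these points. For $m\in\mathbb{P}^{12}$ put $$M(m)=\begin{bmatrix}0&m_0&m_1&m_2\\-m_0&0&m_3&m_4\\m_5&m_6&m_7&m_8\\m_9&m_{10}&m_{11}&m_{12}\end{bmatrix}.$$ Theorem. The vector $\beta_A$ is a Chow form of $A\cdot C$ for every invertible $A$: a line $L\subset\mathbb{P}^3$ meets $A\cdot C$ if and only if $\beta_A^\top\nu_3(L)=0$. Consider the rational map $$\iota_{\mathrm{tw}}:\mathbb{P}^{12}\dashrightarrow\mathrm{Ch}_{\mathrm{tw}}(\mathbb{P}^3),\qquad m\mapsto\nu_3^{5,5}\big(\Sigma\,\wedge^2(M(m)^\top)\,\Sigma\big)^\top\omega^{\mathrm{tw}} .$$ 1. If $M(m)$ is invertible, then $\iota_{\mathrm{tw}}$ is defined at $m$, and $\iota_{\mathrm{tw}}(m)=\beta_{M(m)}$ in $\mathbb{P}^{55}$. 2. $\iota_{\mathrm{tw}}$ has degree $6$: its $56$ coordinates are forms of degree $6$ in $m_0,\dots,m_{12}$ (or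 zero) without a nonconstant common factor. 3. $\iota_{\mathrm{tw}}$ is generically 3-to-1: for all $m$ in a nonempty Zariski-open subset of $\mathbb{P}^{12}$ the map is defined at $m$ and the fiber through $m$ has exactly three points; and all points $\beta$ in a nonempty relatively Zariski-open subset of $\mathrm{Ch}_{\mathrm{tw}}(\mathbb{P}^3)$ have exactly three preimages. 4. $\iota_{\mathrm{tw}}$ is dominant: the Zariski closure of its image is $\mathrm{Ch}_{\mathrm{tw}}(\mathbb{P}^3)$. -/

import Mathlib

open MvPolynomial Matrix
open scoped LinearAlgebra.Projectivization

namespace TwistedCubic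

section Veronese

variable {R S : Type*} [CommRing R] [CommRing S]

/-- The Veronese vector `ν_d(x)`: the vector of all monomials of degree `d` in the entries of `x`.
The monomials are indexed by multisets of size `d`; for `d = 3` and six variables there are 56. -/
def veronese {n : ℕ} (d : ℕ) (x : Fin n → R) : Sym (Fin n) d → R :=
  fun s => ((s : Multiset (Fin n)).map x).prod

/-- The induced matrix `ν_d(A)`: its row `s` is the coefficient vector of the polynomial that is
the monomial `s` evaluated at `A X`, where `X` is the vector of variables. It is characterised by
`ν_d(A x) = ν_d(A) ν_d(x)`, see `veronese_mulVec`. -/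
noncomputable def veroneseMatrix {h n : ℕ} (d : ℕ) (A : Matrix (Fin h) (Fin n) R) :
    Matrix (Sym (Fin h) d) (Sym (Fin n) d) R :=
  fun s t => coeff (Multiset.toFinsupp (t : Multiset (Fin n)))
    (veronese d (fun i => ∑ j, C (A i j) * (X j : MvPolynomial (Fin n) R)) s)

theorem veronese_eq_prod {n d : ℕ} (x : Fin n → R) (s : Sym (Fin n) d) :
    veronese d x s = ∏ i, x i ^ (s : Multiset (Fin n)).count i := by
  rw [veronese, Finset.prod_multiset_map_count]
  refine Finset.prod_subset (Finset.subset_univ _) fun i _ hi => ?_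
  rw [Multiset.count_eq_zero.mpr (by simpa using hi), pow_zero]

theorem sum_coeff_mul_veronese {n d : ℕ} (p : MvPolynomial (Fin n) R) (hp : p.IsHomogeneous d)
    (x : Fin n → R) :
    ∑ t : Sym (Fin n) d, coeff (Multiset.toFinsupp (t : Multiset (Fin n))) p * veronese d x t
      = eval x p := by
  classical
  rw [eval_eq]
  symm
  have hcard : ∀ e ∈ p.support, (Finsupp.toMultiset e).card = d := by
    intro e he
    have := hp (mem_support_iff.mp he)
    rw [Finsupp.card_toMultiset]
    rw [Finsupp.weight_apply] at this
    simpa [Finsupp.sum] using this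
  refine Finset.sum_bij_ne_zero (fun e he _ => Sym.mk (Finsupp.toMultiset e) (hcard e he)) ?_ ?_ ?_ ?_
  · intros; exact Finset.mem_univ _
  · intro e he _ e' he' _ h
    exact Multiset.toFinsupp.symm.injective (congrArg Subtype.val h)
  · intro t _ ht
    have hc : coeff (Multiset.toFinsupp (t : Multiset (Fin n))) p ≠ 0 := left_ne_zero_of_mul ht
    have key : (coeff (Multiset.toFinsupp (t : Multiset (Fin n))) p) *
        ∏ i, x i ^ (Multiset.toFinsupp (t : Multiset (Fin n))) i =
        coeff (Multiset.toFinsupp (t : Multiset (Fin n))) p * veronese d x t := by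
      rw [veronese_eq_prod]
      simp [Multiset.toFinsupp_apply]
    refine ⟨Multiset.toFinsupp (t : Multiset (Fin n)), mem_support_iff.mpr hc, ?_, ?_⟩
    · rw [Finset.prod_subset (Finset.subset_univ _)]
      · rw [key]; exact ht
      · intro i _ hi
        rw [Finsupp.notMem_support_iff.mp hi, pow_zero]
    · apply Subtype.ext
      simp
  · intro e he _
    simp only [Sym.coe_mk, Finsupp.toMultiset_toFinsupp]
    congr 1
    rw [veronese_eq_prod]
    rw [Finset.prod_subset (Finset.subset_univ _)]
    · simp [Finsupp.count_toMultiset]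
    · intro i _ hi
      rw [Finsupp.notMem_support_iff.mp hi, pow_zero]

theorem veronese_mulVec {h n : ℕ} (d : ℕ) (A : Matrix (Fin h) (Fin n) R) (x : Fin n → R) :
    veronese d (A *ᵥ x) = veroneseMatrix d A *ᵥ veronese d x := by
  funext s
  have hs : (veronese d (fun i => ∑ j, C (A i j) * (X j : MvPolynomial (Fin n) R)) s).IsHomogeneous
      d := by
    have h1 : ∀ m : Multiset (Fin h), (m.map (fun i => ∑ j, C (A i j) *
        (X j : MvPolynomial (Fin n) R))).prod.IsHomogeneous m.card := by
      intro m
      induction m using Multiset.induction with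
      | empty => simpa using isHomogeneous_one (Fin n) R
      | cons a m ih =>
        rw [Multiset.map_cons, Multiset.prod_cons, Multiset.card_cons, add_comm]
        refine IsHomogeneous.mul ?_ ih
        refine IsHomogeneous.sum _ _ _ fun j _ => ?_
        simpa using (isHomogeneous_C (Fin n) (A a j)).mul (isHomogeneous_X R j)
    have := h1 (s : Multiset (Fin h))
    rwa [Sym.card_coe] at this
  have := sum_coeff_mul_veronese _ hs x
  rw [mulVec, dotProduct]
  refine Eq.trans ?_ this.symm
  simp only [veronese, map_multiset_prod, Multiset.map_map]
  congr 1
  refine Multiset.map_congr rfl fun i _ => ?_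
  simp [mulVec, dotProduct]

theorem veroneseMatrix_map {h n : ℕ} (d : ℕ) (A : Matrix (Fin h) (Fin n) R) (f : R →+* S) :
    veroneseMatrix d (A.map f) = (veroneseMatrix d A).map f := by
  ext s t
  simp only [veroneseMatrix, Matrix.map_apply, veronese]
  rw [← coeff_map, map_multiset_prod, Multiset.map_map]
  congr 2
  refine Multiset.map_congr rfl fun i _ => ?_
  simp

end Veronese

section Plucker

variable {R S : Type*} [CommRing R] [CommRing S]

/-- The index pairs `12, 13, 14, 23, 24, 34` (counted from `0`), in this order. -/
def pair : Fin 6 → Fin 4 × Fin 4 :=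
  ![(0, 1), (0, 2), (0, 3), (1, 2), (1, 3), (2, 3)]

/-- Plücker vector of the line spanned by `x` and `y`. -/
def plucker (x y : Fin 4 → R) : Fin 6 → R :=
  fun k => x (pair k).1 * y (pair k).2 - x (pair k).2 * y (pair k).1

/-- The second compound matrix `∧² M`, the matrix of all `2 × 2` minors of `M`. -/
def wedgeTwo (M : Matrix (Fin 4) (Fin 4) R) : Matrix (Fin 6) (Fin 6) R :=
  fun k l => M (pair k).1 (pair l).1 * M (pair k).2 (pair l).2
    - M (pair k).1 (pair l).2 * M (pair k).2 (pair l).1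

theorem plucker_mulVec (M : Matrix (Fin 4) (Fin 4) R) (x y : Fin 4 → R) :
    plucker (M *ᵥ x) (M *ᵥ y) = wedgeTwo M *ᵥ plucker x y := by
  funext k
  simp only [plucker, wedgeTwo, mulVec, dotProduct, Fin.sum_univ_four, Fin.sum_univ_six]
  simp only [pair, Matrix.cons_val]
  ring

/-- The signed permutation matrix between primal and dual Plücker coordinates. -/
def sigmaMat : Matrix (Fin 6) (Fin 6) R :=
  !![0,  0, 0, 0,  0, 1;
     0,  0, 0, 0, -1, 0;
     0,  0, 0, 1,  0, 0;
     0,  0, 1, 0,  0, 0;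
     0, -1, 0, 0,  0, 0;
     1,  0, 0, 0,  0, 0]

/-- The cubic in the Plücker coordinates `L₀, …, L₅` that defines the lines meeting the standard
twisted cubic. -/
noncomputable def omegaPoly : MvPolynomial (Fin 6) R :=
  - X 3 ^ 3 - X 3 ^ 2 * X 2 + 2 * X 4 * X 3 * X 1 - X 5 * X 1 ^ 2 - X 4 ^ 2 * X 0
    + X 5 * X 3 * X 0 + X 5 * X 2 * X 0

/-- The coefficient vector `ω^tw` of that cubic, so that `(ω^tw)ᵀ ν_3(L)` is its value at `L`,
see `omegaTw_dotProduct_veronese`. -/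
noncomputable def omegaTw : Sym (Fin 6) 3 → R :=
  fun s => coeff (Multiset.toFinsupp (s : Multiset (Fin 6))) omegaPoly

theorem omegaTw_dotProduct_veronese (L : Fin 6 → R) :
    omegaTw ⬝ᵥ veronese 3 L =
      - L 3 ^ 3 - L 3 ^ 2 * L 2 + 2 * L 4 * L 3 * L 1 - L 5 * L 1 ^ 2 - L 4 ^ 2 * L 0
        + L 5 * L 3 * L 0 + L 5 * L 2 * L 0 := by
  have h3 : ∀ i j k : Fin 6, (X i * X j * X k : MvPolynomial (Fin 6) R).IsHomogeneous 3 :=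
    fun i j k => ((isHomogeneous_X R i).mul (isHomogeneous_X R j)).mul (isHomogeneous_X R k)
  have hp : (omegaPoly : MvPolynomial (Fin 6) R).IsHomogeneous 3 := by
    have e : (omegaPoly : MvPolynomial (Fin 6) R) =
        - (X 3 * X 3 * X 3) - X 3 * X 3 * X 2 + (X 4 * X 3 * X 1 + X 4 * X 3 * X 1)
        - X 5 * X 1 * X 1 - X 4 * X 4 * X 0 + X 5 * X 3 * X 0 + X 5 * X 2 * X 0 := by
      rw [omegaPoly]; ring
    rw [e]
    exact ((((((h3 _ _ _).neg.sub (h3 _ _ _)).add ((h3 _ _ _).add (h3 _ _ _))).sub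
      (h3 _ _ _)).sub (h3 _ _ _)).add (h3 _ _ _)).add (h3 _ _ _)
  refine (sum_coeff_mul_veronese _ hp L).trans ?_
  simp [omegaPoly]

theorem omegaTw_map (f : R →+* S) (s : Sym (Fin 6) 3) : f (omegaTw s) = omegaTw s := by
  rw [omegaTw, ← coeff_map]
  simp [omegaPoly, omegaTw]

/-- The `4 × 4` matrix `M(m)`. -/
def paramMatrix (m : Fin 13 → R) : Matrix (Fin 4) (Fin 4) R :=
  !![0,     m 0,  m 1,  m 2;
     -m 0,  0,    m 3,  m 4;
     m 5,   m 6,  m 7,  m 8;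
     m 9,   m 10, m 11, m 12]

/-- The vector `ν_3(Σ ∧²(M(m)ᵀ) Σ)ᵀ ω^tw` with 56 entries. -/
noncomputable def iotaVec (m : Fin 13 → R) : Sym (Fin 6) 3 → R :=
  (veroneseMatrix 3 (sigmaMat * wedgeTwo (paramMatrix m)ᵀ * sigmaMat))ᵀ *ᵥ omegaTw

theorem iotaVec_map (f : R →+* S) (m : Fin 13 → R) (s : Sym (Fin 6) 3) :
    f (iotaVec m s) = iotaVec (fun i => f (m i)) s := by
  have h1 : sigmaMat * wedgeTwo (paramMatrix fun i => f (m i))ᵀ * sigmaMat =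
      (sigmaMat * wedgeTwo (paramMatrix m)ᵀ * sigmaMat).map f := by
    rw [Matrix.map_mul, Matrix.map_mul]
    have e1 : (sigmaMat : Matrix (Fin 6) (Fin 6) R).map f = sigmaMat := by
      ext i j
      fin_cases i <;> fin_cases j <;> simp [sigmaMat]
    have e2 : (wedgeTwo (paramMatrix m)ᵀ).map f =
        wedgeTwo (paramMatrix fun i => f (m i))ᵀ := by
      have e3 : ∀ i j, f (paramMatrix m i j) = paramMatrix (fun i => f (m i)) i j := by
        intro i j
        fin_cases i <;> fin_cases j <;> simp [paramMatrix]
      ext i j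
      simp [wedgeTwo, e3]
    rw [e1, e2]
  simp only [iotaVec, h1, veroneseMatrix_map]
  simp [mulVec, dotProduct, omegaTw_map]

end Plucker

section Projective

variable {σ τ : Type*}

/-- Zariski closure of a subset of the complex projective space with homogeneous coordinates
indexed by `σ`: the common zeros of all forms that vanish on the subset. -/
def zariskiClosure (Z : Set (ℙ ℂ (σ → ℂ))) : Set (ℙ ℂ (σ → ℂ)) :=
  {p | ∀ (f : MvPolynomial σ ℂ) (k : ℕ), f.IsHomogeneous k →
    (∀ q ∈ Z, eval q.rep f = 0) → eval p.rep f = 0}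

/-- The partial map of projective spaces given by a tuple `F` of forms of one degree, defined where
the forms do not all vanish. If the forms have no common factor, this is the whole domain of
definition of the rational map. -/
noncomputable def ratMap (F : τ → MvPolynomial σ ℂ) : ℙ ℂ (σ → ℂ) →. ℙ ℂ (τ → ℂ) :=
  fun p => ⟨(fun j => eval p.rep (F j)) ≠ 0, fun h => Projectivization.mk ℂ _ h⟩

/-- The rational map given by the tuple `F` has degree `d`: the entries are forms of degree `d`
without a nonconstant common factor. (The zero tuple is excluded, as `0` divides it.) -/
def HasDegree (F : τ → MvPolynomial σ ℂ) (d : ℕ) : Prop :=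
  (∀ j, (F j).IsHomogeneous d) ∧ ∀ g : MvPolynomial σ ℂ, (∀ j, g ∣ F j) → IsUnit g

/-- The fiber of `φ` through a generic point of the source has exactly `n` points. -/
def GenericallyToOneOnSource (φ : ℙ ℂ (σ → ℂ) →. ℙ ℂ (τ → ℂ)) (n : ℕ) : Prop :=
  ∃ (f : MvPolynomial σ ℂ) (k : ℕ), f.IsHomogeneous k ∧ f ≠ 0 ∧
    ∀ p : ℙ ℂ (σ → ℂ), eval p.rep f ≠ 0 → ∃ q ∈ φ p, {p' | q ∈ φ p'}.ncard = n

/-- The fiber of `φ` over a generic point of `Y` has exactly `n` points (for `Y` irreducible, so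
that nonempty relatively open subsets of `Y` are dense). -/
def GenericallyToOneOver (φ : ℙ ℂ (σ → ℂ) →. ℙ ℂ (τ → ℂ)) (Y : Set (ℙ ℂ (τ → ℂ)))
    (n : ℕ) : Prop :=
  ∃ (g : MvPolynomial τ ℂ) (k : ℕ), g.IsHomogeneous k ∧ (∃ q ∈ Y, eval q.rep g ≠ 0) ∧
    ∀ q ∈ Y, eval q.rep g ≠ 0 → {p | q ∈ φ p}.ncard = n

end Projective

/-- The affine vector `(s³, s²t, st², t³)`. -/
def cubicVec (s t : ℂ) : Fin 4 → ℂ := ![s ^ 3, s ^ 2 * t, s * t ^ 2, t ^ 3]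

/-- The image of the standard twisted cubic under the matrix `A`. For invertible `A` these are the
twisted cubics. -/
def twistedCubic (A : Matrix (Fin 4) (Fin 4) ℂ) : Set (ℙ ℂ (Fin 4 → ℂ)) :=
  {p | ∃ (s t : ℂ) (h : A *ᵥ cubicVec s t ≠ 0), p = Projectivization.mk ℂ _ h}

/-- `β` is a cubic Chow form of the space curve `Γ`: a line meets `Γ` if and only if the cubic with
coefficient vector `β` vanishes at the Plücker vector of the line. -/
def IsChowForm (Γ : Set (ℙ ℂ (Fin 4 → ℂ))) (β : Sym (Fin 6) 3 → ℂ) : Prop :=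
  ∀ x y : Fin 4 → ℂ, LinearIndependent ℂ ![x, y] →
    (β ⬝ᵥ veronese 3 (plucker x y) = 0 ↔ ∃ p ∈ Γ, p.rep ∈ Submodule.span ℂ {x, y})

/-- The Chow form of the twisted cubic given by an invertible matrix `A`: the coefficient vector of
the cubic `L ↦ (ω^tw)ᵀ ν_3((∧² A)⁻¹ L)`. -/
noncomputable def chowFormTw (A : Matrix (Fin 4) (Fin 4) ℂ) : Sym (Fin 6) 3 → ℂ :=
  (veroneseMatrix 3 (wedgeTwo A)⁻¹)ᵀ *ᵥ omegaTw

/-- `Ch_tw(ℙ³)`: the Zariski closure in `ℙ⁵⁵` of the set of Chow forms of twisted cubics. -/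
def chTw : Set (ℙ ℂ (Sym (Fin 6) 3 → ℂ)) :=
  zariskiClosure {q | ∃ (A : Matrix (Fin 4) (Fin 4) ℂ) (_ : A.det ≠ 0) (h : chowFormTw A ≠ 0),
    q = Projectivization.mk ℂ _ h}

/-- The 56 polynomials in the coordinates `m₀, …, m₁₂` of `ℙ¹²` that define `ι_tw`: the vector
`ν_3(Σ ∧²(M(m)ᵀ) Σ)ᵀ ω^tw` with `m` the vector of variables. -/
noncomputable def iotaForms : Sym (Fin 6) 3 → MvPolynomial (Fin 13) ℂ :=
  iotaVec (X : Fin 13 → MvPolynomial (Fin 13) ℂ)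

theorem eval_iotaForms (m : Fin 13 → ℂ) (s : Sym (Fin 6) 3) :
    eval m (iotaForms s) = iotaVec m s := by
  rw [iotaForms, iotaVec_map]
  simp

/-- The rational map `ι_tw`. -/
noncomputable def iotaTw : ℙ ℂ (Fin 13 → ℂ) →. ℙ ℂ (Sym (Fin 6) 3 → ℂ) := ratMap iotaForms

end TwistedCubic

namespace TwistedCubic

/-! Write ω for the cubic `omegaEval` and C for the standard twisted cubic. At a line, ω is the
resultant of the two binary cubics obtained by restricting two equations of the line to C, so it
vanishes exactly on the lines that meet C (`omegaEval_sigmaMat_plucker`,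
`omegaEval_plucker_eq_zero_iff`); moving the line by A⁻¹ gives the Chow form of A·C. Laplace
expansion says ∧²M · Σ∧²(Mᵀ)Σ = det M, whence `iotaVec m` is (det M(m))³ times the Chow form of
M(m)·C (`iotaVec_eq_smul`).

Fibers: ω is semi-invariant under Sym³g, g ∈ GL₂, and conversely a B preserving ω up to a factor
maps the cone over C to itself and is some Sym³g (`exists_eq_symCube`). Hence the fiber through m
consists of the matrices M(m)·Sym³g that again have the shape M(m'), up to scalars
(`exists_smul_iotaVec_iff`). Read rows 0 and 1 of M(m) as binary cubics f₀, f₁ and let p, q be the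
columns of g. The shape means f₀(p) = 0, df₁(p)(q) = 0 and df₀(p)(q) + f₁(p) = 0. For generic m, p
is one of the three roots of f₀, and then q solves a nonsingular linear system: three points
(`ncard_fiber`).

The same normalization brings a general A to the shape M(m) without changing A·C, which gives
dominance (`eval_chowFormTw_eq_zero`). By Chevalley's theorem the image of the generic locus
contains a nonempty open part of its closure, so general points of the closure also have three
preimages. Finally, a common factor of the 56 forms divides both the resultant of rows 0, 1 and that
of rows 2, 3; these share no variable, so the factor is constant. -/

theorem eval_const_mul {ι : Type*} {f : MvPolynomial ι ℂ} {k : ℕ} (hf : f.IsHomogeneous k)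
    (c : ℂ) (y : ι → ℂ) : eval (fun j => c * y j) f = c ^ k * eval y f := by
  rw [eval_eq, eval_eq, Finset.mul_sum]
  refine Finset.sum_congr rfl fun e he => ?_
  have hk : ∑ i ∈ e.support, e i = k := by
    have := hf (mem_support_iff.mp he)
    rw [Finsupp.weight_apply] at this
    simpa [Finsupp.sum] using this
  simp only [mul_pow, Finset.prod_mul_distrib, Finset.prod_pow_eq_pow_sum, hk]
  ring

theorem eval_const_mul_eq_sum {τ : Type*} (f : MvPolynomial τ ℂ) (c : ℂ) (y : τ → ℂ) :
    eval (fun j => c * y j) f =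
      ∑ i ∈ Finset.range (f.totalDegree + 1), c ^ i * eval y (homogeneousComponent i f) := by
  conv_lhs => rw [← sum_homogeneousComponent f]
  rw [map_sum]
  refine Finset.sum_congr rfl fun i _ => ?_
  exact eval_const_mul (homogeneousComponent_isHomogeneous i f) c y

theorem eval_aeval {σ τ : Type*} (F : τ → MvPolynomial σ ℂ) (f : MvPolynomial τ ℂ) (x : σ → ℂ) :
    eval x (aeval F f) = eval (fun j => eval x (F j)) f := by
  rw [← coe_aeval_eq_eval, ← coe_aeval_eq_eval]
  change aeval x (aeval F f) = aeval _ f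
  rw [← AlgHom.comp_apply]
  congr 1
  ext j
  simp

/-! ### Images of polynomial maps: Chevalley's theorem, affine and projective. -/

section Image

variable {σ τ : Type*} [Finite σ] [Finite τ]

/-- A consequence of Chevalley's theorem: the image of the complement of a hypersurface under a
polynomial map contains a nonempty open subset of its closure. -/
theorem exists_forall_exists_eval_eq (F : τ → MvPolynomial σ ℂ) {h : MvPolynomial σ ℂ}
    (hh : h ≠ 0) :
    ∃ r : MvPolynomial τ ℂ, aeval F r ≠ 0 ∧ ∀ y : τ → ℂ,
      (∀ f : MvPolynomial τ ℂ, aeval F f = 0 → eval y f = 0) → eval y r ≠ 0 →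
      ∃ x : σ → ℂ, eval x h ≠ 0 ∧ ∀ j, eval x (F j) = y j := by
  let φ : MvPolynomial τ ℂ →ₐ[ℂ] MvPolynomial σ ℂ := aeval F
  have hφ : φ.toRingHom.FinitePresentation := by
    refine RingHom.FinitePresentation.of_finiteType.mp ?_
    refine RingHom.FiniteType.of_comp_finiteType (f := C) (g := φ.toRingHom) ?_
    have e : φ.toRingHom.comp C = algebraMap ℂ (MvPolynomial σ ℂ) := by
      ext x
      simp [φ]
    rw [e, RingHom.finiteType_algebraMap]
    infer_instance
  obtain ⟨S, hS⟩ := PrimeSpectrum.exists_constructibleSetData_iff.mpr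
    (PrimeSpectrum.isConstructible_comap_image hφ
      (PrimeSpectrum.isConstructible_basicOpen (f := h)))
  -- The generic point lies in D(h), so its image, the kernel of φ, lies in one locally closed piece
  -- V(I) \ V(D.f). Since I ⊆ ker φ, every y in the closure with D.f(y) ≠ 0 lies in this piece.
  have hgen : PrimeSpectrum.comap φ.toRingHom ⊥ ∈ S.toSet := by
    rw [hS]
    exact ⟨⊥, by simpa using hh, rfl⟩
  simp only [PrimeSpectrum.ConstructibleSetData.toSet, Set.mem_iUnion] at hgen
  obtain ⟨D, hD, hgen⟩ := hgen
  have hker : ∀ f, f ∈ (PrimeSpectrum.comap φ.toRingHom ⊥).asIdeal ↔ aeval F f = 0 := by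
    intro f
    simp [φ]
  refine ⟨D.f, fun h0 => hgen.2 ?_, fun y hy hr => ?_⟩
  · rw [PrimeSpectrum.mem_zeroLocus, Set.singleton_subset_iff]
    exact (hker _).mpr h0
  have hmem : (pointToPoint y : PrimeSpectrum (MvPolynomial τ ℂ)) ∈ S.toSet := by
    simp only [PrimeSpectrum.ConstructibleSetData.toSet, Set.mem_iUnion]
    refine ⟨D, hD, ?_, ?_⟩
    · rw [PrimeSpectrum.mem_zeroLocus]
      intro f hf
      refine (mem_vanishingIdeal_singleton_iff y f).mpr ?_
      simpa using hy f ((hker f).mp (hgen.1 hf))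
    · rw [PrimeSpectrum.mem_zeroLocus, Set.singleton_subset_iff]
      intro hf
      exact hr (by simpa using (mem_vanishingIdeal_singleton_iff y D.f).mp hf)
  rw [hS] at hmem
  obtain ⟨P, hP, hPy⟩ := hmem
  -- P is only a prime over y; the Nullstellensatz supplies a closed point x of V(P) with h(x) ≠ 0.
  have hhP : h ∉ vanishingIdeal ℂ (zeroLocus ℂ P.asIdeal) := by
    rw [IsPrime.vanishingIdeal_zeroLocus]
    exact hP
  simp only [mem_vanishingIdeal_iff, not_forall] at hhP
  obtain ⟨x, hx, hxh⟩ := hhP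
  refine ⟨x, by simpa using hxh, fun j => ?_⟩
  have hj : (X j - C (y j) : MvPolynomial τ ℂ) ∈ (PrimeSpectrum.comap φ.toRingHom P).asIdeal := by
    rw [hPy]
    refine (mem_vanishingIdeal_singleton_iff y _).mpr ?_
    simp
  have := hx _ hj
  simpa [φ, sub_eq_zero] using this

/-- The image of a nonempty open set under a tuple of forms of one positive degree contains, up to
scalars, a nonempty open subset of its closure. -/
theorem exists_isHomogeneous_forall_exists_eval_eq {d : ℕ} (hd : 0 < d)
    {F : τ → MvPolynomial σ ℂ} (hF : ∀ j, (F j).IsHomogeneous d) {h : MvPolynomial σ ℂ}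
    (hh : h ≠ 0) :
    ∃ (g : MvPolynomial τ ℂ) (k : ℕ), g.IsHomogeneous k ∧
      (∃ x : σ → ℂ, eval (fun j => eval x (F j)) g ≠ 0) ∧ ∀ y : τ → ℂ,
      (∀ (f : MvPolynomial τ ℂ) (i : ℕ), f.IsHomogeneous i →
        (∀ x : σ → ℂ, eval (fun j => eval x (F j)) f = 0) → eval y f = 0) → eval y g ≠ 0 →
      ∃ (x : σ → ℂ) (c : ℂ), c ≠ 0 ∧ eval x h ≠ 0 ∧ ∀ j, eval x (F j) = c * y j := by
  obtain ⟨r, hr, H⟩ := exists_forall_exists_eval_eq F hh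
  have hk : ∃ k, aeval F (homogeneousComponent k r) ≠ 0 := by
    by_contra! hc
    apply hr
    rw [← sum_homogeneousComponent r, map_sum]
    exact Finset.sum_eq_zero fun i _ => hc i
  obtain ⟨k, hk⟩ := hk
  refine ⟨homogeneousComponent k r, k, homogeneousComponent_isHomogeneous k r, ?_, ?_⟩
  · by_contra! hc
    exact hk (MvPolynomial.funext fun x => by rw [eval_aeval, hc x, map_zero])
  intro y hy hyk
  -- p(c) = r(c·y), a nonzero polynomial because its k-th coefficient is. The extra factor X below
  -- forces c ≠ 0.
  let p : Polynomial ℂ := ∑ i ∈ Finset.range (r.totalDegree + 1),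
    Polynomial.monomial i (eval y (homogeneousComponent i r))
  have hp : p * Polynomial.X ≠ 0 := by
    refine mul_ne_zero (fun h0 => hyk ?_) Polynomial.X_ne_zero
    have h1 := congrArg (fun q => Polynomial.coeff q k) h0
    simp only [p, Polynomial.finsetSum_coeff, Polynomial.coeff_monomial, Polynomial.coeff_zero,
      Finset.sum_ite_eq', Finset.mem_range] at h1
    split_ifs at h1 with hlt
    · exact h1
    · rw [homogeneousComponent_eq_zero _ _ (by omega), map_zero]
  obtain ⟨c, hc⟩ : ∃ c, Polynomial.eval c (p * Polynomial.X) ≠ 0 := by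
    by_contra! h0
    exact hp (Polynomial.funext fun c => by simpa using h0 c)
  rw [Polynomial.eval_mul, Polynomial.eval_X] at hc
  have hpc : eval (fun j => c * y j) r = Polynomial.eval c p := by
    rw [eval_const_mul_eq_sum]
    simp [p, Polynomial.eval_finsetSum, mul_comm]
  -- The relations among the F j form a homogeneous ideal: component i of f is sent to degree d·i,
  -- and these degrees are distinct because d > 0.
  have hcl : ∀ f, aeval F f = 0 → eval (fun j => c * y j) f = 0 := by
    intro f hf
    rw [eval_const_mul_eq_sum]
    refine Finset.sum_eq_zero fun i hi => ?_
    rw [hy _ i (homogeneousComponent_isHomogeneous i f), mul_zero]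
    intro x
    rw [← eval_aeval]
    have hhom : ∀ i, (aeval F (homogeneousComponent i f)).IsHomogeneous (d * i) := by
      intro i
      simpa using (homogeneousComponent_isHomogeneous i f).aeval F hF
    have h2 : homogeneousComponent (d * i) (aeval F f) = aeval F (homogeneousComponent i f) := by
      conv_lhs => rw [← sum_homogeneousComponent f]
      rw [map_sum, map_sum]
      rw [Finset.sum_eq_single i]
      · rw [homogeneousComponent_of_mem (hhom i), if_pos rfl]
      · intro j _ hji
        rw [homogeneousComponent_of_mem (hhom j), if_neg]
        intro h3
        exact hji (Nat.eq_of_mul_eq_mul_left hd h3).symm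
      · exact fun h3 => absurd hi h3
    rw [← h2, hf]
    simp
  obtain ⟨x, hx, hxy⟩ := H (fun j => c * y j) hcl (hpc ▸ left_ne_zero_of_mul hc)
  exact ⟨x, c, right_ne_zero_of_mul hc, hx, hxy⟩

end Image

/-! ### The Chow cubic and second compound matrices. -/

section Forms

variable {R : Type*} [CommRing R]

/-- The cubic `L ↦ (ω^tw)ᵀ ν_3(L)`. -/
def omegaEval (L : Fin 6 → R) : R :=
  - L 3 ^ 3 - L 3 ^ 2 * L 2 + 2 * L 4 * L 3 * L 1 - L 5 * L 1 ^ 2 - L 4 ^ 2 * L 0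
    + L 5 * L 3 * L 0 + L 5 * L 2 * L 0

theorem transpose_veroneseMatrix_dotProduct {h n d : ℕ} (B : Matrix (Fin h) (Fin n) R)
    (β : Sym (Fin h) d → R) (L : Fin n → R) :
    ((veroneseMatrix d B)ᵀ *ᵥ β) ⬝ᵥ veronese d L = β ⬝ᵥ veronese d (B *ᵥ L) := by
  rw [veronese_mulVec, mulVec_transpose, dotProduct_mulVec]

/-- The matrix `Σ ∧²(Mᵀ) Σ`, a complementary second compound matrix. -/
def coWedgeTwo (M : Matrix (Fin 4) (Fin 4) R) : Matrix (Fin 6) (Fin 6) R :=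
  sigmaMat * wedgeTwo Mᵀ * sigmaMat

theorem iotaVec_dotProduct_veronese (m : Fin 13 → R) (L : Fin 6 → R) :
    iotaVec m ⬝ᵥ veronese 3 L = omegaEval (coWedgeTwo (paramMatrix m) *ᵥ L) := by
  rw [iotaVec, transpose_veroneseMatrix_dotProduct, omegaTw_dotProduct_veronese]
  rfl

theorem chowFormTw_dotProduct_veronese (A : Matrix (Fin 4) (Fin 4) ℂ) (L : Fin 6 → ℂ) :
    chowFormTw A ⬝ᵥ veronese 3 L = omegaEval ((wedgeTwo A)⁻¹ *ᵥ L) := by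
  rw [chowFormTw, transpose_veroneseMatrix_dotProduct, omegaTw_dotProduct_veronese]
  rfl

theorem omegaEval_smul (c : R) (L : Fin 6 → R) : omegaEval (c • L) = c ^ 3 * omegaEval L := by
  simp only [omegaEval, Pi.smul_apply, smul_eq_mul]
  ring

theorem sigmaMat_mulVec (L : Fin 6 → R) :
    sigmaMat *ᵥ L = ![L 5, -L 4, L 3, L 2, -L 1, L 0] := by
  funext k
  fin_cases k <;> simp [sigmaMat, mulVec, dotProduct, Fin.sum_univ_six]

theorem wedgeTwo_mulVec_single (M : Matrix (Fin 4) (Fin 4) R) (l : Fin 6) :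
    wedgeTwo M *ᵥ Pi.single l 1 = plucker (M.col (pair l).1) (M.col (pair l).2) := by
  rw [mulVec_single_one]
  funext k
  simp only [col_apply, wedgeTwo, plucker]
  ring

theorem wedgeTwo_mul (A B : Matrix (Fin 4) (Fin 4) R) :
    wedgeTwo (A * B) = wedgeTwo A * wedgeTwo B := by
  have hcol : ∀ j, (A * B).col j = A *ᵥ B.col j := fun j => rfl
  refine Matrix.ext_of_mulVec_single fun l => ?_
  rw [← mulVec_mulVec, wedgeTwo_mulVec_single, wedgeTwo_mulVec_single, hcol, hcol,
    plucker_mulVec]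

theorem wedgeTwo_one : wedgeTwo (1 : Matrix (Fin 4) (Fin 4) R) = 1 := by
  ext k l
  fin_cases k <;> fin_cases l <;> simp [wedgeTwo, pair, Matrix.one_apply]

theorem wedgeTwo_transpose (M : Matrix (Fin 4) (Fin 4) R) : wedgeTwo Mᵀ = (wedgeTwo M)ᵀ := by
  ext k l
  simp only [wedgeTwo, transpose_apply]
  ring

theorem coWedgeTwo_apply (M : Matrix (Fin 4) (Fin 4) R) (k l : Fin 6) :
    coWedgeTwo M k l = ![1, -1, 1, 1, -1, 1] k * ![1, -1, 1, 1, -1, 1] l *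
      wedgeTwo M (![5, 4, 3, 2, 1, 0] l) (![5, 4, 3, 2, 1, 0] k) := by
  rw [coWedgeTwo, wedgeTwo_transpose]
  simp only [Matrix.mul_apply, Fin.sum_univ_six, transpose_apply]
  fin_cases k <;> fin_cases l <;> simp [sigmaMat]

theorem det_fin_four (M : Matrix (Fin 4) (Fin 4) R) :
    M.det = wedgeTwo M 0 0 * wedgeTwo M 5 5 - wedgeTwo M 0 1 * wedgeTwo M 5 4
      + wedgeTwo M 0 2 * wedgeTwo M 5 3 + wedgeTwo M 0 3 * wedgeTwo M 5 2
      - wedgeTwo M 0 4 * wedgeTwo M 5 1 + wedgeTwo M 0 5 * wedgeTwo M 5 0 := by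
  rw [det_succ_row_zero]
  simp [Fin.sum_univ_succ, det_fin_three, wedgeTwo, pair, Fin.succAbove]
  ring

/-- Laplace expansion along two rows. -/
theorem wedgeTwo_mul_coWedgeTwo (M : Matrix (Fin 4) (Fin 4) R) :
    wedgeTwo M * coWedgeTwo M = M.det • 1 := by
  rw [det_fin_four]
  ext k l
  simp only [Matrix.mul_apply, Fin.sum_univ_six, coWedgeTwo_apply, Matrix.smul_apply, one_apply]
  fin_cases k <;> fin_cases l <;> simp [wedgeTwo, pair] <;> ring

end Forms

/-! ### Sym³ of a 2 × 2 matrix and the semi-invariance of the Chow cubic. -/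

section SymCube

variable {R : Type*} [CommRing R]

/-- The symmetric cube of a `2 × 2` matrix, in the basis `s³, s²t, st², t³`. -/
def symCube (g : Matrix (Fin 2) (Fin 2) R) : Matrix (Fin 4) (Fin 4) R :=
  !![g 0 0 ^ 3, 3 * g 0 0 ^ 2 * g 0 1, 3 * g 0 0 * g 0 1 ^ 2, g 0 1 ^ 3;
     g 0 0 ^ 2 * g 1 0, g 0 0 ^ 2 * g 1 1 + 2 * g 0 0 * g 0 1 * g 1 0,
       2 * g 0 0 * g 0 1 * g 1 1 + g 0 1 ^ 2 * g 1 0, g 0 1 ^ 2 * g 1 1;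
     g 0 0 * g 1 0 ^ 2, 2 * g 0 0 * g 1 0 * g 1 1 + g 0 1 * g 1 0 ^ 2,
       g 0 0 * g 1 1 ^ 2 + 2 * g 0 1 * g 1 0 * g 1 1, g 0 1 * g 1 1 ^ 2;
     g 1 0 ^ 3, 3 * g 1 0 ^ 2 * g 1 1, 3 * g 1 0 * g 1 1 ^ 2, g 1 1 ^ 3]

theorem symCube_mulVec_cubicVec (g : Matrix (Fin 2) (Fin 2) ℂ) (s t : ℂ) :
    symCube g *ᵥ cubicVec s t = cubicVec (g 0 0 * s + g 0 1 * t) (g 1 0 * s + g 1 1 * t) := by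
  funext k
  fin_cases k <;> simp [symCube, cubicVec, mulVec, dotProduct, Fin.sum_univ_four] <;> ring

theorem symCube_mul (g h : Matrix (Fin 2) (Fin 2) R) :
    symCube (g * h) = symCube g * symCube h := by
  ext i j
  simp only [Matrix.mul_apply, Fin.sum_univ_four]
  fin_cases i <;> fin_cases j <;>
    simp [symCube, Matrix.mul_apply, Fin.sum_univ_two] <;> ring

theorem symCube_one : symCube (1 : Matrix (Fin 2) (Fin 2) R) = 1 := by
  ext i j
  fin_cases i <;> fin_cases j <;> simp [symCube]

theorem symCube_smul (c : R) (g : Matrix (Fin 2) (Fin 2) R) :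
    symCube (c • g) = c ^ 3 • symCube g := by
  ext i j
  fin_cases i <;> fin_cases j <;> simp [symCube] <;> ring

/-- The symmetric matrix whose determinant is the Chow form of the standard twisted cubic. -/
def bezoutMat (L : Fin 6 → R) : Matrix (Fin 3) (Fin 3) R :=
  !![L 0, L 1, L 3; L 1, L 2 + L 3, L 4; L 3, L 4, L 5]

theorem det_bezoutMat (L : Fin 6 → R) : (bezoutMat L).det = omegaEval L := by
  simp [bezoutMat, det_fin_three, omegaEval]
  ring

/-- The action of a `2 × 2` matrix on products of two linear forms. -/
def symSquare (g : Matrix (Fin 2) (Fin 2) R) : Matrix (Fin 3) (Fin 3) R :=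
  !![g 0 0 ^ 2, g 0 0 * g 0 1, g 0 1 ^ 2;
     2 * g 0 0 * g 1 0, g 0 0 * g 1 1 + g 0 1 * g 1 0, 2 * g 0 1 * g 1 1;
     g 1 0 ^ 2, g 1 0 * g 1 1, g 1 1 ^ 2]

theorem det_symSquare (g : Matrix (Fin 2) (Fin 2) R) : (symSquare g).det = g.det ^ 3 := by
  simp [symSquare, det_fin_three, det_fin_two]
  ring

/-- Up to order and signs, `bezoutMat` is the Bezout matrix of the two binary cubics cut out on C by
equations of the line; a linear substitution changes a Bezout matrix by a congruence and a factor.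
-/
theorem bezoutMat_wedgeTwo_symCube (g : Matrix (Fin 2) (Fin 2) R) (L : Fin 6 → R) :
    bezoutMat (wedgeTwo (symCube g) *ᵥ L) =
      g.det • (symSquare g * bezoutMat L * (symSquare g)ᵀ) := by
  ext i j
  simp only [Matrix.smul_apply, Matrix.mul_apply, Fin.sum_univ_three, transpose_apply, det_fin_two,
    smul_eq_mul]
  fin_cases i <;> fin_cases j <;>
    simp [bezoutMat, symSquare, mulVec, dotProduct, Fin.sum_univ_six, wedgeTwo, pair, symCube] <;>
    ring

/-- The exponent is 3 + 2·3: the scalar factor enters a 3 × 3 determinant, and `symSquare g`, of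
determinant (det g)³, occurs twice. -/
theorem omegaEval_wedgeTwo_symCube (g : Matrix (Fin 2) (Fin 2) R) (L : Fin 6 → R) :
    omegaEval (wedgeTwo (symCube g) *ᵥ L) = g.det ^ 9 * omegaEval L := by
  rw [← det_bezoutMat, bezoutMat_wedgeTwo_symCube, det_smul, det_mul, det_mul, det_transpose,
    det_symSquare, det_bezoutMat, Fintype.card_fin]
  ring

end SymCube

/-! ### Coefficient vectors compared through their values; `iotaVec` against `chowFormTw`. -/

section Evaluation

/-- A coefficient vector is determined by the values of its form. -/
theorem dotProduct_veronese_injective {n d : ℕ} {β γ : Sym (Fin n) d → ℂ}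
    (h : ∀ L, β ⬝ᵥ veronese d L = γ ⬝ᵥ veronese d L) : β = γ := by
  classical
  let P : (Sym (Fin n) d → ℂ) → MvPolynomial (Fin n) ℂ := fun β =>
    ∑ s : Sym (Fin n) d, monomial (Multiset.toFinsupp (s : Multiset (Fin n))) (β s)
  have hP : ∀ β L, eval L (P β) = β ⬝ᵥ veronese d L := by
    intro β L
    simp only [P, map_sum, eval_monomial, dotProduct]
    refine Finset.sum_congr rfl fun s _ => ?_
    rw [veronese_eq_prod, Finsupp.prod_fintype _ _ fun i => pow_zero _]
    simp [Multiset.toFinsupp_apply]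
  have hPe : P β = P γ := MvPolynomial.funext fun L => by rw [hP, hP, h]
  funext s
  have hc : ∀ β, coeff (Multiset.toFinsupp (s : Multiset (Fin n))) (P β) = β s := by
    intro β
    simp only [P, coeff_sum, coeff_monomial]
    rw [Finset.sum_eq_single s]
    · simp
    · intro t _ hts
      rw [if_neg]
      intro e
      exact hts (Subtype.ext (Multiset.toFinsupp.injective e))
    · intro hs
      exact absurd (Finset.mem_univ _) hs
  rw [← hc β, hPe, hc γ]

theorem isUnit_det_wedgeTwo {A : Matrix (Fin 4) (Fin 4) ℂ} (hA : A.det ≠ 0) :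
    IsUnit (wedgeTwo A).det := by
  have h : wedgeTwo A * wedgeTwo A⁻¹ = 1 := by
    rw [← wedgeTwo_mul, mul_nonsing_inv _ hA.isUnit, wedgeTwo_one]
  exact (isUnit_iff_isUnit_det _).mp (IsUnit.of_mul_eq_one _ h)

theorem wedgeTwo_inv {A : Matrix (Fin 4) (Fin 4) ℂ} (hA : A.det ≠ 0) :
    (wedgeTwo A)⁻¹ = wedgeTwo A⁻¹ := by
  refine inv_eq_right_inv ?_
  rw [← wedgeTwo_mul, mul_nonsing_inv _ hA.isUnit, wedgeTwo_one]

theorem coWedgeTwo_eq_smul {A : Matrix (Fin 4) (Fin 4) ℂ} (hA : A.det ≠ 0) :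
    coWedgeTwo A = A.det • (wedgeTwo A)⁻¹ := by
  have h := congrArg (fun B => (wedgeTwo A)⁻¹ * B) (wedgeTwo_mul_coWedgeTwo A)
  simpa [← mul_assoc, nonsing_inv_mul _ (isUnit_det_wedgeTwo hA)] using h

theorem iotaVec_eq_smul {m : Fin 13 → ℂ} (hm : (paramMatrix m).det ≠ 0) :
    iotaVec m = (paramMatrix m).det ^ 3 • chowFormTw (paramMatrix m) := by
  refine dotProduct_veronese_injective fun L => ?_
  rw [iotaVec_dotProduct_veronese, smul_dotProduct, chowFormTw_dotProduct_veronese,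
    coWedgeTwo_eq_smul hm, smul_mulVec, omegaEval_smul, smul_eq_mul]

theorem chowFormTw_ne_zero {A : Matrix (Fin 4) (Fin 4) ℂ} (hA : A.det ≠ 0) :
    chowFormTw A ≠ 0 := by
  intro h
  have h1 := chowFormTw_dotProduct_veronese A (wedgeTwo A *ᵥ ![0, 0, 0, 1, 0, 0])
  rw [h, zero_dotProduct, mulVec_mulVec, nonsing_inv_mul _ (isUnit_det_wedgeTwo hA),
    one_mulVec] at h1
  simp [omegaEval] at h1

end Evaluation

/-! ### Lines that meet the twisted cubic. -/

section ChowForm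

theorem cubicVec_eq_zero_iff {s t : ℂ} : cubicVec s t = 0 ↔ s = 0 ∧ t = 0 := by
  constructor
  · intro h
    have h0 := congrFun h 0
    have h3 := congrFun h 3
    simp [cubicVec] at h0 h3
    exact ⟨h0, h3⟩
  · rintro ⟨rfl, rfl⟩
    funext k
    fin_cases k <;> simp [cubicVec]

theorem omegaEval_plucker_cubicVec (s t : ℂ) (z : Fin 4 → ℂ) :
    omegaEval (plucker (cubicVec s t) z) = 0 := by
  simp [omegaEval, plucker, pair, cubicVec]
  ring

theorem exists_quadratic_factorization (c₀ c₁ c₂ : ℂ) :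
    ∃ a₁ b₁ a₂ b₂ : ℂ, c₀ = a₁ * a₂ ∧ c₁ = a₁ * b₂ + b₁ * a₂ ∧ c₂ = b₁ * b₂ := by
  by_cases h : c₀ = 0
  · exact ⟨0, 1, c₁, c₂, by simp [h], by ring, by ring⟩
  · obtain ⟨e, he⟩ := IsAlgClosed.exists_eq_mul_self (discrim c₀ c₁ c₂)
    obtain ⟨r, hr⟩ := exists_quadratic_eq_zero h ⟨e, he⟩
    exact ⟨1, -r, c₀, c₁ + c₀ * r, by ring, by ring, by linear_combination hr⟩

theorem exists_cubic_root {c₀ : ℂ} (c₁ c₂ c₃ : ℂ) (h : c₀ ≠ 0) :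
    ∃ r : ℂ, c₀ * r ^ 3 + c₁ * r ^ 2 + c₂ * r + c₃ = 0 := by
  have hd : (Cubic.mk c₀ c₁ c₂ c₃).toPoly.degree ≠ 0 := by
    rw [Cubic.degree_of_a_ne_zero h]
    decide
  obtain ⟨r, hr⟩ := IsAlgClosed.exists_root _ hd
  exact ⟨r, by simpa [Cubic.toPoly] using hr⟩

/-- The coefficients of the binary cubic form `∏ i, (a i * s + b i * t)`. -/
def cubicOfFactors (a b : Fin 3 → ℂ) : Fin 4 → ℂ :=
  ![a 0 * a 1 * a 2, a 0 * a 1 * b 2 + a 0 * b 1 * a 2 + b 0 * a 1 * a 2,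
    a 0 * b 1 * b 2 + b 0 * a 1 * b 2 + b 0 * b 1 * a 2, b 0 * b 1 * b 2]

theorem exists_eq_cubicOfFactors (f : Fin 4 → ℂ) : ∃ a b, f = cubicOfFactors a b := by
  -- If the leading coefficient vanishes, t is a factor; otherwise s − r·t is one for a root r, with
  -- quotient given by Horner's scheme.
  by_cases h : f 0 = 0
  · obtain ⟨a₁, b₁, a₂, b₂, h0, h1, h2⟩ := exists_quadratic_factorization (f 1) (f 2) (f 3)
    refine ⟨![0, a₁, a₂], ![1, b₁, b₂], ?_⟩
    funext k
    fin_cases k <;> simp [cubicOfFactors, h, h0, h1, h2]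
  · obtain ⟨r, hr⟩ := exists_cubic_root (f 1) (f 2) (f 3) h
    obtain ⟨a₁, b₁, a₂, b₂, h0, h1, h2⟩ :=
      exists_quadratic_factorization (f 0) (f 1 + f 0 * r) (f 2 + f 1 * r + f 0 * r ^ 2)
    refine ⟨![1, a₁, a₂], ![-r, b₁, b₂], ?_⟩
    funext k
    fin_cases k <;> simp [cubicOfFactors]
    · exact h0
    · linear_combination h1 - r * h0
    · linear_combination h2 - r * h1
    · linear_combination hr - r * h2

theorem cubicOfFactors_dotProduct (a b : Fin 3 → ℂ) (s t : ℂ) :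
    cubicOfFactors a b ⬝ᵥ cubicVec s t =
      (a 0 * s + b 0 * t) * (a 1 * s + b 1 * t) * (a 2 * s + b 2 * t) := by
  simp [cubicOfFactors, cubicVec, dotProduct, Fin.sum_univ_four]
  ring

/-- In dual coordinates the Chow form of the standard twisted cubic is the resultant of two binary
cubic forms. -/
theorem omegaEval_sigmaMat_plucker (a b : Fin 3 → ℂ) (g : Fin 4 → ℂ) :
    omegaEval (sigmaMat *ᵥ plucker (cubicOfFactors a b) g) =
      (g ⬝ᵥ cubicVec (b 0) (-a 0)) * (g ⬝ᵥ cubicVec (b 1) (-a 1)) *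
        (g ⬝ᵥ cubicVec (b 2) (-a 2)) := by
  rw [sigmaMat_mulVec]
  simp [omegaEval, plucker, pair, cubicOfFactors, cubicVec, dotProduct, Fin.sum_univ_four]
  ring

theorem exists_common_root {f g : Fin 4 → ℂ} (hf : f ≠ 0)
    (h : omegaEval (sigmaMat *ᵥ plucker f g) = 0) :
    ∃ s t : ℂ, cubicVec s t ≠ 0 ∧ f ⬝ᵥ cubicVec s t = 0 ∧ g ⬝ᵥ cubicVec s t = 0 := by
  obtain ⟨a, b, rfl⟩ := exists_eq_cubicOfFactors f
  have key : ∀ i, ¬ (a i = 0 ∧ b i = 0) := by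
    rintro i ⟨ha, hb⟩
    apply hf
    funext k
    fin_cases i <;> fin_cases k <;> simp_all [cubicOfFactors]
  have hi : ∃ i, g ⬝ᵥ cubicVec (b i) (-a i) = 0 := by
    rw [omegaEval_sigmaMat_plucker, mul_eq_zero, mul_eq_zero] at h
    rcases h with (h | h) | h
    exacts [⟨0, h⟩, ⟨1, h⟩, ⟨2, h⟩]
  obtain ⟨i, hi⟩ := hi
  refine ⟨b i, -a i, ?_, ?_, hi⟩
  · rw [Ne, cubicVec_eq_zero_iff, neg_eq_zero]
    exact fun h => key i h.symm
  · rw [cubicOfFactors_dotProduct]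
    fin_cases i <;> simp <;> ring_nf <;> simp

theorem exists_matrix_col_eq {x y : Fin 4 → ℂ} (h : LinearIndependent ℂ ![x, y]) :
    ∃ P : Matrix (Fin 4) (Fin 4) ℂ, P.det ≠ 0 ∧ P.col 0 = x ∧ P.col 1 = y := by
  obtain ⟨z, hz⟩ := exists_linearIndependent_snoc_of_lt_finrank (n := 2) h (by simp)
  obtain ⟨w, hw⟩ := exists_linearIndependent_snoc_of_lt_finrank (n := 3) hz (by simp)
  let Q : Matrix (Fin 4) (Fin 4) ℂ := Fin.snoc (α := fun _ => Fin 4 → ℂ)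
    (Fin.snoc (α := fun _ => Fin 4 → ℂ) ![x, y] z : Fin 3 → Fin 4 → ℂ) w
  have hQ : IsUnit Q := linearIndependent_rows_iff_isUnit.mp hw
  refine ⟨Qᵀ, ?_, rfl, rfl⟩
  rw [det_transpose]
  exact ((isUnit_iff_isUnit_det _).mp hQ).ne_zero

theorem omegaEval_plucker_eq_zero_iff {x y : Fin 4 → ℂ} (h : LinearIndependent ℂ ![x, y]) :
    omegaEval (plucker x y) = 0 ↔
      ∃ s t : ℂ, cubicVec s t ≠ 0 ∧ ∃ a b : ℂ, cubicVec s t = a • x + b • y := by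
  constructor
  · intro h0
    -- With x, y as the first two columns of P, rows 2 and 3 of P⁻¹ are equations of the line. Their
    -- dual Plücker vector is a multiple of the primal one, so the resultant of these two rows
    -- vanishes.
    obtain ⟨P, hP, hx, hy⟩ := exists_matrix_col_eq h
    have hQ : P⁻¹.det ≠ 0 := by
      rw [det_nonsing_inv]
      exact (hP.isUnit.ringInverse).ne_zero
    have e1 : plucker x y = wedgeTwo P *ᵥ Pi.single 0 1 := by
      rw [wedgeTwo_mulVec_single, ← hx, ← hy]
      rfl
    have e2 : coWedgeTwo P⁻¹ *ᵥ Pi.single 0 1 = P⁻¹.det • plucker x y := by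
      rw [coWedgeTwo_eq_smul hQ, wedgeTwo_inv hQ, nonsing_inv_nonsing_inv _ hP.isUnit, smul_mulVec,
        e1]
    have e3 : coWedgeTwo P⁻¹ *ᵥ Pi.single 0 1 = sigmaMat *ᵥ plucker (P⁻¹ 2) (P⁻¹ 3) := by
      rw [coWedgeTwo, ← mulVec_mulVec, ← mulVec_mulVec]
      have e4 : (sigmaMat *ᵥ Pi.single 0 1 : Fin 6 → ℂ) = Pi.single 5 1 := by
        rw [sigmaMat_mulVec]
        funext k
        fin_cases k <;> simp
      rw [e4, wedgeTwo_mulVec_single]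
      rfl
    have e5 : omegaEval (sigmaMat *ᵥ plucker (P⁻¹ 2) (P⁻¹ 3)) = 0 := by
      rw [← e3, e2, omegaEval_smul, h0, mul_zero]
    have hrow : P⁻¹ 2 ≠ 0 := fun h2 => hQ (det_eq_zero_of_row_eq_zero 2 fun j => congrFun h2 j)
    obtain ⟨s, t, hst, hf, hg⟩ := exists_common_root hrow e5
    refine ⟨s, t, hst, P⁻¹ 0 ⬝ᵥ cubicVec s t, P⁻¹ 1 ⬝ᵥ cubicVec s t, ?_⟩
    have e6 : cubicVec s t = P *ᵥ (P⁻¹ *ᵥ cubicVec s t) := by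
      rw [mulVec_mulVec, mul_nonsing_inv _ hP.isUnit, one_mulVec]
    conv_lhs => rw [e6]
    funext k
    have hf' : (P⁻¹ *ᵥ cubicVec s t) 2 = 0 := hf
    have hg' : (P⁻¹ *ᵥ cubicVec s t) 3 = 0 := hg
    rw [mulVec, dotProduct, Fin.sum_univ_four, hf', hg', ← hx, ← hy]
    simp only [Pi.add_apply, Pi.smul_apply, smul_eq_mul, col_apply, mulVec]
    ring
  · rintro ⟨s, t, hst, a, b, e⟩
    -- One of a, b is nonzero, so the line is spanned by the point of C and one of y, x.
    have h1 : a • plucker x y = plucker (cubicVec s t) y := by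
      rw [e]
      funext k
      simp only [plucker, Pi.add_apply, Pi.smul_apply, smul_eq_mul]
      ring
    have h2 : (-b) • plucker x y = plucker (cubicVec s t) x := by
      rw [e]
      funext k
      simp only [plucker, Pi.add_apply, Pi.smul_apply, smul_eq_mul]
      ring
    have h3 := congrArg omegaEval h1
    have h4 := congrArg omegaEval h2
    rw [omegaEval_smul, omegaEval_plucker_cubicVec, mul_eq_zero] at h3 h4
    rcases h3 with h3 | h3
    · rcases h4 with h4 | h4
      · refine absurd ?_ hst
        rw [e, pow_eq_zero_iff (by norm_num) |>.mp h3,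
          neg_eq_zero.mp (pow_eq_zero_iff (by norm_num) |>.mp h4)]
        simp
      · exact h4
    · exact h3

theorem isChowForm_chowFormTw {A : Matrix (Fin 4) (Fin 4) ℂ} (hA : A.det ≠ 0) :
    IsChowForm (twistedCubic A) (chowFormTw A) := by
  intro x y hxy
  have hinj : Function.Injective (A⁻¹).mulVecLin := by
    rw [coe_mulVecLin]
    exact mulVec_injective_iff_isUnit.mpr ((isUnit_nonsing_inv_iff).mpr
      ((isUnit_iff_isUnit_det _).mpr hA.isUnit))
  have hxy' : LinearIndependent ℂ ![A⁻¹ *ᵥ x, A⁻¹ *ᵥ y] := by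
    have e : ⇑(A⁻¹).mulVecLin ∘ ![x, y] = ![A⁻¹ *ᵥ x, A⁻¹ *ᵥ y] := by
      funext i
      fin_cases i <;> rfl
    rw [← e]
    exact hxy.map' (A⁻¹).mulVecLin (LinearMap.ker_eq_bot.mpr hinj)
  have hAA : ∀ v, A *ᵥ (A⁻¹ *ᵥ v) = v := fun v => by
    rw [mulVec_mulVec, mul_nonsing_inv _ hA.isUnit, one_mulVec]
  have hAA' : ∀ v, A⁻¹ *ᵥ (A *ᵥ v) = v := fun v => by
    rw [mulVec_mulVec, nonsing_inv_mul _ hA.isUnit, one_mulVec]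
  rw [chowFormTw_dotProduct_veronese, wedgeTwo_inv hA, ← plucker_mulVec,
    omegaEval_plucker_eq_zero_iff hxy']
  constructor
  · rintro ⟨s, t, hst, a, b, e⟩
    have hne : A *ᵥ cubicVec s t ≠ 0 := fun h0 =>
      hst (by rw [← hAA' (cubicVec s t), h0, mulVec_zero])
    refine ⟨_, ⟨s, t, hne, rfl⟩, ?_⟩
    obtain ⟨c, hc⟩ := Projectivization.exists_smul_eq_mk_rep ℂ _ hne
    rw [← hc, e, mulVec_add, mulVec_smul, mulVec_smul, hAA, hAA]
    exact Submodule.smul_mem _ _ (Submodule.mem_span_pair.mpr ⟨a, b, rfl⟩)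
  · rintro ⟨p, ⟨s, t, hne, rfl⟩, hp⟩
    obtain ⟨c, hc⟩ := Projectivization.exists_smul_eq_mk_rep ℂ _ hne
    rw [← hc] at hp
    have hp' : A *ᵥ cubicVec s t ∈ Submodule.span ℂ {x, y} :=
      (Submodule.smul_mem_iff_of_isUnit _ c.isUnit).mp hp
    obtain ⟨a, b, e⟩ := Submodule.mem_span_pair.mp hp'
    refine ⟨s, t, fun h0 => hne (by rw [h0, mulVec_zero]), a, b, ?_⟩
    rw [← mulVec_smul, ← mulVec_smul, ← mulVec_add, e, hAA']

end ChowForm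

/-! ### The stabilizer of the Chow cubic in GL₄ is the image of Sym³. -/

section Stabilizer

theorem exists_pow_three_eq (c : ℂ) : ∃ s : ℂ, s ^ 3 = c :=
  IsAlgClosed.exists_pow_nat_eq c (by norm_num)

/-- A point all of whose lines meet the standard twisted cubic lies on it. -/
theorem exists_eq_cubicVec {y : Fin 4 → ℂ} (h : ∀ z, omegaEval (plucker y z) = 0) :
    ∃ s t, y = cubicVec s t := by
  have h1 := h ![0, 1, 0, 0]
  have h2 := h ![0, 0, 1, 0]
  have h3 := h ![0, 1, 1, 0]
  have h4 := h ![0, 1, -1, 0]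
  simp [omegaEval, plucker, pair] at h1 h2 h3 h4
  have e1 : y 2 ^ 3 = y 0 * y 3 ^ 2 := by linear_combination h1
  have e2 : y 1 ^ 3 = y 0 ^ 2 * y 3 := by linear_combination -h2
  have e3 : y 1 * (y 1 * y 2 - y 0 * y 3) = 0 := by
    linear_combination (1 / 6) * h3 + (1 / 6) * h4 - (1 / 3) * h1
  by_cases h0 : y 0 = 0
  · have h1' : y 1 = 0 := by
      rw [h0] at e2
      simpa using e2
    have h2' : y 2 = 0 := by
      rw [h0] at e1
      simpa using e1
    obtain ⟨t, ht⟩ := exists_pow_three_eq (y 3)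
    refine ⟨0, t, ?_⟩
    funext k
    fin_cases k <;> simp [cubicVec, h0, h1', h2', ht]
  · obtain ⟨s, hs⟩ := exists_pow_three_eq (y 0)
    have hs0 : s ≠ 0 := by
      rintro rfl
      exact h0 (by simp [← hs])
    have ht : y 1 = s ^ 2 * (y 1 / s ^ 2) := by field_simp
    generalize y 1 / s ^ 2 = t at ht
    have h3' : y 3 = t ^ 3 := by
      refine mul_left_cancel₀ (pow_ne_zero 2 h0) ?_
      rw [← e2, ht, ← hs]
      ring
    have h2' : y 2 = s * t ^ 2 := by
      by_cases ht0 : t = 0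
      · have : y 2 ^ 3 = 0 := by rw [e1, h3', ht0]; ring
        rw [ht0]
        simpa using this
      · have hy1 : y 1 ≠ 0 := by
          rw [ht]
          exact mul_ne_zero (pow_ne_zero 2 hs0) ht0
        refine mul_left_cancel₀ hy1 ?_
        have := (mul_eq_zero.mp e3).resolve_left hy1
        rw [sub_eq_zero] at this
        rw [this, ht, h3', ← hs]
        ring
    refine ⟨s, t, ?_⟩
    funext k
    fin_cases k <;> simp [cubicVec, hs, ht, h2', h3']

/-- A quintic without constant term has the root 0, so five more roots make it zero. -/
theorem coeff_eq_zero_of_forall_eq_zero {c₁ c₂ c₃ c₄ c₅ : ℂ}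
    (h : ∀ s : ℂ, c₁ * s + c₂ * s ^ 2 + c₃ * s ^ 3 + c₄ * s ^ 4 + c₅ * s ^ 5 = 0) :
    c₁ = 0 ∧ c₂ = 0 ∧ c₃ = 0 ∧ c₄ = 0 ∧ c₅ = 0 := by
  have h1 := h 1
  have h2 := h (-1)
  have h3 := h 2
  have h4 := h (-2)
  have h5 := h 3
  grind

theorem eq_symCube_of_fixed {B : Matrix (Fin 4) (Fin 4) ℂ} (hB : B.det ≠ 0)
    (hC : ∀ s t, ∃ s' t', B *ᵥ cubicVec s t = cubicVec s' t')
    (h0 : B *ᵥ cubicVec 1 0 = cubicVec 1 0) (h3 : B *ᵥ cubicVec 0 1 = cubicVec 0 1) :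
    ∃ g, B = symCube g := by
  have c0 : ∀ i, B i 0 = cubicVec 1 0 i := fun i => by
    rw [← h0]
    simp [mulVec, dotProduct, cubicVec, Fin.sum_univ_four]
  have c3 : ∀ i, B i 3 = cubicVec 0 1 i := fun i => by
    rw [← h3]
    simp [mulVec, dotProduct, cubicVec, Fin.sum_univ_four]
  have hF : ∀ (s : ℂ) (i : Fin 4), (B *ᵥ cubicVec s 1) i =
      cubicVec 1 0 i * s ^ 3 + B i 1 * s ^ 2 + B i 2 * s + cubicVec 0 1 i := fun s i => by
    rw [← c0, ← c3]
    simp [mulVec, dotProduct, cubicVec, Fin.sum_univ_four]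
  -- The image of (s³, s², s, 1) satisfies the quadrics y₀y₂ = y₁² and y₁y₃ = y₂² of C. Comparing
  -- powers of s leaves B = diag(1, b, b², 1) with b³ = 1.
  have hQ : ∀ s : ℂ, (s ^ 3 + B 0 1 * s ^ 2 + B 0 2 * s) * (B 2 1 * s ^ 2 + B 2 2 * s) =
      (B 1 1 * s ^ 2 + B 1 2 * s) ^ 2 ∧ (B 1 1 * s ^ 2 + B 1 2 * s) *
      (B 3 1 * s ^ 2 + B 3 2 * s + 1) = (B 2 1 * s ^ 2 + B 2 2 * s) ^ 2 := by
    intro s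
    obtain ⟨u, v, huv⟩ := hC s 1
    have f0 := hF s 0
    have f1 := hF s 1
    have f2 := hF s 2
    have f3 := hF s 3
    rw [huv] at f0 f1 f2 f3
    simp [cubicVec] at f0 f1 f2 f3
    rw [← f0, ← f1, ← f2, ← f3]
    constructor <;> ring
  obtain ⟨-, k2, k3, k4, k5⟩ := coeff_eq_zero_of_forall_eq_zero
    (c₁ := 0) (c₂ := B 0 2 * B 2 2 - B 1 2 ^ 2)
    (c₃ := B 0 1 * B 2 2 + B 0 2 * B 2 1 - 2 * B 1 1 * B 1 2)
    (c₄ := B 2 2 + B 0 1 * B 2 1 - B 1 1 ^ 2) (c₅ := B 2 1)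
    fun s => by linear_combination (hQ s).1
  obtain ⟨l1, l2, l3, l4, -⟩ := coeff_eq_zero_of_forall_eq_zero
    (c₁ := B 1 2) (c₂ := B 1 1 + B 1 2 * B 3 2 - B 2 2 ^ 2)
    (c₃ := B 1 1 * B 3 2 + B 1 2 * B 3 1 - 2 * B 2 1 * B 2 2)
    (c₄ := B 1 1 * B 3 1 - B 2 1 ^ 2) (c₅ := 0)
    fun s => by linear_combination (hQ s).2
  simp only [k5, l1] at k2 k3 k4 l2 l3 l4
  have k4' : B 2 2 = B 1 1 ^ 2 := by linear_combination k4
  have l2' : B 1 1 = B 2 2 ^ 2 := by linear_combination l2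
  have hb : B 1 1 ≠ 0 := by
    intro hb
    refine hB (det_eq_zero_of_row_eq_zero 1 fun j => ?_)
    fin_cases j
    · simp [c0, cubicVec]
    · exact hb
    · exact l1
    · simp [c3, cubicVec]
  have hb3 : B 1 1 ^ 3 = 1 := by
    refine mul_left_cancel₀ hb ?_
    rw [k4'] at l2'
    linear_combination -l2'
  have hb2 : B 2 2 ≠ 0 := by
    rw [k4']
    exact pow_ne_zero 2 hb
  have b01 : B 0 1 = 0 := by simpa [hb2] using k3
  have b02 : B 0 2 = 0 := by simpa [hb2] using k2
  have b31 : B 3 1 = 0 := by simpa [hb] using l4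
  have b32 : B 3 2 = 0 := by simpa [hb] using l3
  refine ⟨!![1, 0; 0, B 1 1], ?_⟩
  ext i j
  fin_cases i <;> fin_cases j <;>
    simp [symCube, c0, c3, cubicVec, b01, b02, b31, b32, k5, l1, k4', hb3]

theorem symCube_mul_inv {g : Matrix (Fin 2) (Fin 2) ℂ} (hg : g.det ≠ 0) :
    symCube g * symCube g⁻¹ = 1 := by
  rw [← symCube_mul, mul_nonsing_inv _ hg.isUnit, symCube_one]

theorem symCube_inv {g : Matrix (Fin 2) (Fin 2) ℂ} (hg : g.det ≠ 0) :
    (symCube g)⁻¹ = symCube g⁻¹ :=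
  inv_eq_right_inv (symCube_mul_inv hg)

theorem det_symCube_ne_zero {g : Matrix (Fin 2) (Fin 2) ℂ} (hg : g.det ≠ 0) :
    (symCube g).det ≠ 0 := by
  intro h
  have := congrArg det (symCube_mul_inv hg)
  rw [det_mul, h, zero_mul, det_one] at this
  exact zero_ne_one this

theorem plucker_cubicVec (p₀ p₁ q₀ q₁ : ℂ) :
    plucker (cubicVec p₀ p₁) (cubicVec q₀ q₁) = (p₀ * q₁ - q₀ * p₁) •
      ![p₀ ^ 2 * q₀ ^ 2, p₀ * q₀ * (p₀ * q₁ + p₁ * q₀),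
        p₀ ^ 2 * q₁ ^ 2 + p₀ * p₁ * q₀ * q₁ + p₁ ^ 2 * q₀ ^ 2, p₀ * p₁ * q₀ * q₁,
        p₁ * q₁ * (p₀ * q₁ + p₁ * q₀), p₁ ^ 2 * q₁ ^ 2] := by
  funext k
  fin_cases k <;> simp [plucker, pair, cubicVec] <;> ring

/-- The linear automorphisms that preserve the Chow form of the standard twisted cubic up to a
factor are symmetric cubes. -/
theorem exists_eq_symCube {B : Matrix (Fin 4) (Fin 4) ℂ} (hB : B.det ≠ 0) {c : ℂ}
    (h : ∀ L, omegaEval (wedgeTwo B *ᵥ L) = c * omegaEval L) :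
    ∃ g, g.det ≠ 0 ∧ B = symCube g := by
  -- Every line through the image point is the image of a line through a point of C, so ω vanishes
  -- on it.
  have hC : ∀ s t, ∃ s' t', B *ᵥ cubicVec s t = cubicVec s' t' := by
    intro s t
    refine exists_eq_cubicVec fun z => ?_
    have hz : z = B *ᵥ (B⁻¹ *ᵥ z) := by
      rw [mulVec_mulVec, mul_nonsing_inv _ hB.isUnit, one_mulVec]
    rw [hz, plucker_mulVec, h, omegaEval_plucker_cubicVec, mul_zero]
  obtain ⟨p₀, p₁, hp⟩ := hC 1 0
  obtain ⟨q₀, q₁, hq⟩ := hC 0 1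
  -- Sym³g agrees with B at the two coordinate points of C, so (Sym³g)⁻¹B fixes both as vectors.
  let g : Matrix (Fin 2) (Fin 2) ℂ := !![p₀, q₀; p₁, q₁]
  have hg : g.det ≠ 0 := by
    intro h0
    have h1 : plucker (cubicVec p₀ p₁) (cubicVec q₀ q₁) = 0 := by
      rw [plucker_cubicVec]
      rw [det_fin_two] at h0
      have : p₀ * q₁ - q₀ * p₁ = 0 := h0
      rw [this, zero_smul]
    rw [← hp, ← hq, plucker_mulVec] at h1
    have h2 := (mulVec_injective_of_isUnit
      ((isUnit_iff_isUnit_det _).mpr (isUnit_det_wedgeTwo hB))) (h1.trans (mulVec_zero _).symm)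
    have h3 := congrFun h2 2
    simp [plucker, pair, cubicVec] at h3
  have hg' : g⁻¹.det ≠ 0 := by
    rw [det_nonsing_inv]
    exact (hg.isUnit.ringInverse).ne_zero
  have hginv : ∀ v, symCube g⁻¹ *ᵥ (symCube g *ᵥ v) = v := fun v => by
    rw [mulVec_mulVec, ← symCube_mul, nonsing_inv_mul _ hg.isUnit, symCube_one, one_mulVec]
  obtain ⟨k, hk⟩ := eq_symCube_of_fixed (B := symCube g⁻¹ * B)
    (by rw [det_mul]; exact mul_ne_zero (det_symCube_ne_zero hg') hB)
    (fun s t => by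
      obtain ⟨s', t', e⟩ := hC s t
      exact ⟨_, _, by rw [← mulVec_mulVec, e, symCube_mulVec_cubicVec]⟩)
    (by
      rw [← mulVec_mulVec, hp]
      have : cubicVec p₀ p₁ = symCube g *ᵥ cubicVec 1 0 := by
        rw [symCube_mulVec_cubicVec]
        simp [g]
      rw [this, hginv])
    (by
      rw [← mulVec_mulVec, hq]
      have : cubicVec q₀ q₁ = symCube g *ᵥ cubicVec 0 1 := by
        rw [symCube_mulVec_cubicVec]
        simp [g]
      rw [this, hginv])
  have hBk : B = symCube (g * k) := by
    rw [symCube_mul, ← hk, ← mul_assoc, symCube_mul_inv hg, one_mul]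
  refine ⟨g * k, fun h0 => ?_, hBk⟩
  have h1 := omegaEval_wedgeTwo_symCube (g * k) ((wedgeTwo B)⁻¹ *ᵥ ![0, 0, 0, 1, 0, 0])
  rw [← hBk, mulVec_mulVec, mul_nonsing_inv _ (isUnit_det_wedgeTwo hB), one_mulVec, h0] at h1
  simp [omegaEval] at h1

/-- The cubic `ω^tw` is not a cone. -/
theorem eq_zero_of_omegaEval_add {w : Fin 6 → ℂ}
    (h : ∀ (L : Fin 6 → ℂ) (c : ℂ), omegaEval (L + c • w) = omegaEval L) : w = 0 := by
  -- The derivative of ω at L along w: the odd part in c of ω(L + c·w), minus its cubic term ω(w) =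
  -- 0. Suitable L then isolate the entries of w.
  have hd : ∀ L : Fin 6 → ℂ,
      - 3 * L 3 ^ 2 * w 3 - 2 * L 3 * w 3 * L 2 - L 3 ^ 2 * w 2
        + 2 * (w 4 * L 3 * L 1 + L 4 * w 3 * L 1 + L 4 * L 3 * w 1)
        - w 5 * L 1 ^ 2 - 2 * L 5 * L 1 * w 1 - 2 * L 4 * w 4 * L 0 - L 4 ^ 2 * w 0
        + w 5 * L 3 * L 0 + L 5 * w 3 * L 0 + L 5 * L 3 * w 0
        + w 5 * L 2 * L 0 + L 5 * w 2 * L 0 + L 5 * L 2 * w 0 = 0 := by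
    intro L
    have h1 := h L 1
    have h2 := h L (-1)
    have h3 := h 0 1
    simp [omegaEval] at h1 h2 h3
    linear_combination (1 / 2) * h1 - (1 / 2) * h2 - h3
  have d1 := hd ![0, 0, 0, 1, 0, 0]
  have d2 := hd ![0, 1, 0, 0, 0, 0]
  have d3 := hd ![0, 0, 0, 0, 1, 0]
  have d4 := hd ![1, 0, 0, 0, 0, 1]
  have d5 := hd ![0, 0, 0, 1, 1, 0]
  have d6 := hd ![0, 1, 0, 1, 0, 0]
  simp at d1 d2 d3 d4 d5 d6
  have w3 : w 3 = 0 := by linear_combination (-1 / 2) * d1 - (1 / 2) * d4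
  have w2 : w 2 = 0 := by linear_combination d4 - w3
  have w1 : w 1 = 0 := by linear_combination (1 / 2) * d5 - (1 / 2) * d1 + (1 / 2) * d3
  have w4 : w 4 = 0 := by linear_combination (1 / 2) * d6 - (1 / 2) * d1 + (1 / 2) * d2
  funext k
  fin_cases k <;> simp [w1, w2, w3, w4, d2, d3]

/-- For v in the kernel of B', the cubic ω is invariant under translation by B v, so B v = 0 because
ω is not a cone. -/
theorem det_ne_zero_of_omegaEval_mulVec {B B' : Matrix (Fin 6) (Fin 6) ℂ} (hB : B.det ≠ 0) {c : ℂ}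
    (hc : c ≠ 0) (h : ∀ L, omegaEval (B' *ᵥ L) = c * omegaEval (B *ᵥ L)) : B'.det ≠ 0 := by
  intro h0
  obtain ⟨v, hv, hBv⟩ := exists_mulVec_eq_zero_iff.mpr h0
  have hw : B *ᵥ v = 0 := by
    refine eq_zero_of_omegaEval_add fun L a => ?_
    have hL : L = B *ᵥ (B⁻¹ *ᵥ L) := by
      rw [mulVec_mulVec, mul_nonsing_inv _ hB.isUnit, one_mulVec]
    refine mul_left_cancel₀ hc ?_
    rw [hL, ← mulVec_smul, ← mulVec_add, ← h, ← h, mulVec_add, mulVec_smul, hBv, smul_zero,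
      add_zero]
  exact hB (exists_mulVec_eq_zero_iff.mp ⟨v, hv, hw⟩)

/-- If det M = 0, the Laplace identity forces ∧²M = 0, while `coWedgeTwo M` has the same entries as
∧²M up to position and sign. -/
theorem det_ne_zero_of_det_coWedgeTwo_ne_zero {M : Matrix (Fin 4) (Fin 4) ℂ}
    (h : (coWedgeTwo M).det ≠ 0) : M.det ≠ 0 := by
  intro h0
  have h1 := wedgeTwo_mul_coWedgeTwo M
  rw [h0, zero_smul] at h1
  have h2 : wedgeTwo M = 0 := by
    have := congrArg (fun X => X * (coWedgeTwo M)⁻¹) h1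
    simpa [mul_assoc, mul_nonsing_inv _ h.isUnit] using this
  apply h
  rw [coWedgeTwo, wedgeTwo_transpose, h2]
  simp

theorem chowFormTw_mul_symCube {A : Matrix (Fin 4) (Fin 4) ℂ} (hA : A.det ≠ 0)
    {g : Matrix (Fin 2) (Fin 2) ℂ} (hg : g.det ≠ 0) :
    chowFormTw (A * symCube g) = g⁻¹.det ^ 9 • chowFormTw A := by
  have hAg : (A * symCube g).det ≠ 0 := by
    rw [det_mul]
    exact mul_ne_zero hA (det_symCube_ne_zero hg)
  refine dotProduct_veronese_injective fun L => ?_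
  rw [smul_dotProduct, chowFormTw_dotProduct_veronese, chowFormTw_dotProduct_veronese,
    wedgeTwo_inv hAg, wedgeTwo_inv hA, Matrix.mul_inv_rev, symCube_inv hg, wedgeTwo_mul,
    ← mulVec_mulVec, omegaEval_wedgeTwo_symCube, smul_eq_mul]

/-- Invertibility of M(m') is a consequence, not an assumption: a singular matrix would give a
degenerate cubic. The stabilizer theorem then applies to M(m)⁻¹M(m'). -/
theorem exists_smul_iotaVec_iff {m m' : Fin 13 → ℂ} (hm : (paramMatrix m).det ≠ 0) :
    (∃ c : ℂ, c ≠ 0 ∧ iotaVec m' = c • iotaVec m) ↔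
      ∃ g : Matrix (Fin 2) (Fin 2) ℂ, g.det ≠ 0 ∧ paramMatrix m' = paramMatrix m * symCube g := by
  constructor
  · rintro ⟨c, hc, h⟩
    have hL : ∀ L, omegaEval (coWedgeTwo (paramMatrix m') *ᵥ L) =
        c * omegaEval (coWedgeTwo (paramMatrix m) *ᵥ L) := by
      intro L
      rw [← iotaVec_dotProduct_veronese, ← iotaVec_dotProduct_veronese, h, smul_dotProduct,
        smul_eq_mul]
    have hco : (coWedgeTwo (paramMatrix m)).det ≠ 0 := by
      rw [coWedgeTwo_eq_smul hm, det_smul, det_nonsing_inv]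
      exact mul_ne_zero (pow_ne_zero _ hm) (isUnit_det_wedgeTwo hm).ringInverse.ne_zero
    have hm' : (paramMatrix m').det ≠ 0 :=
      det_ne_zero_of_det_coWedgeTwo_ne_zero (det_ne_zero_of_omegaEval_mulVec hco hc hL)
    have hB : ((paramMatrix m)⁻¹ * paramMatrix m').det ≠ 0 := by
      rw [det_mul, det_nonsing_inv]
      exact mul_ne_zero hm.isUnit.ringInverse.ne_zero hm'
    obtain ⟨g, hg, e⟩ := exists_eq_symCube hB
      (c := (paramMatrix m').det ^ 3 / (c * (paramMatrix m).det ^ 3)) fun K => by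
        have := hL (wedgeTwo (paramMatrix m') *ᵥ K)
        rw [coWedgeTwo_eq_smul hm, coWedgeTwo_eq_smul hm', smul_mulVec, smul_mulVec, mulVec_mulVec,
          mulVec_mulVec, nonsing_inv_mul _ (isUnit_det_wedgeTwo hm'), one_mulVec, omegaEval_smul,
          omegaEval_smul, wedgeTwo_inv hm, ← wedgeTwo_mul] at this
        field_simp
        linear_combination -this
    refine ⟨g, hg, ?_⟩
    rw [← e, ← mul_assoc, mul_nonsing_inv _ hm.isUnit, one_mul]
  · rintro ⟨g, hg, h⟩
    have hm' : (paramMatrix m').det ≠ 0 := by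
      rw [h, det_mul]
      exact mul_ne_zero hm (det_symCube_ne_zero hg)
    have hg' : g⁻¹.det ≠ 0 := by
      rw [det_nonsing_inv]
      exact hg.isUnit.ringInverse.ne_zero
    refine ⟨(paramMatrix m').det ^ 3 * g⁻¹.det ^ 9 / (paramMatrix m).det ^ 3, ?_, ?_⟩
    · exact div_ne_zero (mul_ne_zero (pow_ne_zero _ hm') (pow_ne_zero _ hg')) (pow_ne_zero _ hm)
    · rw [iotaVec_eq_smul hm, iotaVec_eq_smul hm', smul_smul, div_mul_cancel₀ _ (pow_ne_zero _ hm),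
        ← smul_smul, ← chowFormTw_mul_symCube hm hg, ← h]

end Stabilizer

/-! ### Normalizing matrices to the shape M(m): the three points of a generic fiber. -/

section Fiber

/-- The parameters of a matrix of the form `M(m)`. -/
def paramOf (N : Matrix (Fin 4) (Fin 4) ℂ) : Fin 13 → ℂ :=
  ![N 0 1, N 0 2, N 0 3, N 1 2, N 1 3, N 2 0, N 2 1, N 2 2, N 2 3, N 3 0, N 3 1, N 3 2, N 3 3]

theorem paramOf_paramMatrix (m : Fin 13 → ℂ) : paramOf (paramMatrix m) = m := by
  funext k
  fin_cases k <;> rfl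

theorem paramMatrix_injective : Function.Injective (paramMatrix : (Fin 13 → ℂ) → _) :=
  Function.LeftInverse.injective paramOf_paramMatrix

theorem paramMatrix_smul (c : ℂ) (m : Fin 13 → ℂ) : paramMatrix (c • m) = c • paramMatrix m := by
  ext i j
  fin_cases i <;> fin_cases j <;> simp [paramMatrix]

theorem paramMatrix_paramOf {N : Matrix (Fin 4) (Fin 4) ℂ} (h0 : N 0 0 = 0) (h1 : N 1 1 = 0)
    (h2 : N 0 1 + N 1 0 = 0) : paramMatrix (paramOf N) = N := by
  have h2' : -N 0 1 = N 1 0 := by linear_combination -h2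
  ext i j
  fin_cases i <;> fin_cases j <;> simp [paramMatrix, paramOf, h0, h1, h2']

/-- The differential of the binary cubic form with coefficient vector `f` at `(a, c)`, applied to
`(b, d)`. -/
def cubicDiff (f : Fin 4 → ℂ) (a c b d : ℂ) : ℂ :=
  (3 * f 0 * a ^ 2 + 2 * f 1 * a * c + f 2 * c ^ 2) * b +
    (f 1 * a ^ 2 + 2 * f 2 * a * c + 3 * f 3 * c ^ 2) * d

theorem mul_symCube_apply_zero (N : Matrix (Fin 4) (Fin 4) ℂ) (g : Matrix (Fin 2) (Fin 2) ℂ)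
    (i : Fin 4) : (N * symCube g) i 0 = N i ⬝ᵥ cubicVec (g 0 0) (g 1 0) := by
  simp [Matrix.mul_apply, symCube, dotProduct, cubicVec, Fin.sum_univ_four]

theorem mul_symCube_apply_one (N : Matrix (Fin 4) (Fin 4) ℂ) (g : Matrix (Fin 2) (Fin 2) ℂ)
    (i : Fin 4) : (N * symCube g) i 1 = cubicDiff (N i) (g 0 0) (g 1 0) (g 0 1) (g 1 1) := by
  simp [Matrix.mul_apply, symCube, cubicDiff, Fin.sum_univ_four]
  ring

theorem cubicDiff_self (f : Fin 4 → ℂ) (a c : ℂ) :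
    cubicDiff f a c a c = 3 * (f ⬝ᵥ cubicVec a c) := by
  simp [cubicDiff, dotProduct, cubicVec, Fin.sum_univ_four]
  ring

/-- The normalization conditions on the second column of `g`, given its first column. -/
theorem exists_second_column {f₀ f₁ : Fin 4 → ℂ} {a c : ℂ} (h0 : f₀ ⬝ᵥ cubicVec a c = 0)
    (h1 : f₁ ⬝ᵥ cubicVec a c ≠ 0) (hd : ∃ b d, cubicDiff f₀ a c b d ≠ 0) :
    ∃ b d, a * d - b * c ≠ 0 ∧ cubicDiff f₁ a c b d = 0 ∧
      cubicDiff f₀ a c b d + f₁ ⬝ᵥ cubicVec a c = 0 := by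
  have e0 := cubicDiff_self f₀ a c
  have e1 := cubicDiff_self f₁ a c
  rw [h0, mul_zero] at e0
  simp only [cubicDiff] at e0 e1 hd ⊢
  generalize f₁ ⬝ᵥ cubicVec a c = F at *
  generalize 3 * f₀ 0 * a ^ 2 + 2 * f₀ 1 * a * c + f₀ 2 * c ^ 2 = x at *
  generalize f₀ 1 * a ^ 2 + 2 * f₀ 2 * a * c + 3 * f₀ 3 * c ^ 2 = y at *
  generalize 3 * f₁ 0 * a ^ 2 + 2 * f₁ 1 * a * c + f₁ 2 * c ^ 2 = u at *
  generalize f₁ 1 * a ^ 2 + 2 * f₁ 2 * a * c + 3 * f₁ 3 * c ^ 2 = v at *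
  -- By Euler's relation (x, y) annihilates (a, c), while (u, v) takes the value 3F ≠ 0 there; so
  -- the two differentials are independent. The solution below is Cramer's rule.
  have hJ : x * (-v) + y * u ≠ 0 := by
    intro hJ
    obtain ⟨b, d, hbd⟩ := hd
    have hx : x * (3 * F) = 0 := by linear_combination -x * e1 + u * e0 - c * hJ
    have hy : y * (3 * F) = 0 := by linear_combination -y * e1 + v * e0 + a * hJ
    have h3 : 3 * F ≠ 0 := mul_ne_zero (by norm_num) h1
    have hx' := (mul_eq_zero.mp hx).resolve_right h3
    have hy' := (mul_eq_zero.mp hy).resolve_right h3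
    exact hbd (by rw [hx', hy']; ring)
  obtain ⟨J, hJe⟩ : ∃ J, J = x * (-v) + y * u := ⟨_, rfl⟩
  rw [← hJe] at hJ
  refine ⟨F * v / J, -(F * u) / J, ?_, ?_, ?_⟩
  · have : a * (-(F * u) / J) - F * v / J * c = -3 * F ^ 2 / J := by
      field_simp
      linear_combination -e1
    rw [this]
    exact div_ne_zero (mul_ne_zero (by norm_num) (pow_ne_zero 2 h1)) hJ
  · field_simp
    ring
  · field_simp
    linear_combination F * hJe

/-- A root fixes the first column of g only up to a factor k. The second column must scale by the
same k, so that g is determined up to a scalar. -/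
theorem second_column_unique {f₀ f₁ : Fin 4 → ℂ} {a c b d b' d' k : ℂ} (hk : k ≠ 0)
    (h1 : f₁ ⬝ᵥ cubicVec a c ≠ 0) (h : cubicDiff f₁ a c b d = 0)
    (hs : cubicDiff f₀ a c b d + f₁ ⬝ᵥ cubicVec a c = 0)
    (h' : cubicDiff f₁ (k * a) (k * c) b' d' = 0)
    (hs' : cubicDiff f₀ (k * a) (k * c) b' d' + f₁ ⬝ᵥ cubicVec (k * a) (k * c) = 0) :
    b' = k * b ∧ d' = k * d := by
  have e1 := cubicDiff_self f₁ a c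
  have hF : f₁ ⬝ᵥ cubicVec (k * a) (k * c) = k ^ 3 * (f₁ ⬝ᵥ cubicVec a c) := by
    simp [dotProduct, cubicVec, Fin.sum_univ_four]
    ring
  have hD : ∀ f : Fin 4 → ℂ, cubicDiff f (k * a) (k * c) b' d' =
      k ^ 2 * cubicDiff f a c b' d' := fun f => by
    simp only [cubicDiff]
    ring
  rw [hD] at h' hs'
  rw [hF] at hs'
  have h'' : cubicDiff f₁ a c b' d' = 0 := by simpa [hk] using h'
  have hs'' : cubicDiff f₀ a c b' d' + k * (f₁ ⬝ᵥ cubicVec a c) = 0 := by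
    refine (mul_eq_zero.mp ?_).resolve_left (pow_ne_zero 2 hk)
    linear_combination hs'
  simp only [cubicDiff] at e1 h hs h'' hs''
  generalize f₁ ⬝ᵥ cubicVec a c = F at *
  generalize 3 * f₀ 0 * a ^ 2 + 2 * f₀ 1 * a * c + f₀ 2 * c ^ 2 = x at *
  generalize f₀ 1 * a ^ 2 + 2 * f₀ 2 * a * c + 3 * f₀ 3 * c ^ 2 = y at *
  generalize 3 * f₁ 0 * a ^ 2 + 2 * f₁ 1 * a * c + f₁ 2 * c ^ 2 = u at *
  generalize f₁ 1 * a ^ 2 + 2 * f₁ 2 * a * c + 3 * f₁ 3 * c ^ 2 = v at *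
  have hJ : x * v - y * u ≠ 0 := by
    intro hJ
    have hv : F * v = 0 := by linear_combination -b * hJ + v * hs - y * h
    have hu : F * u = 0 := by linear_combination d * hJ - x * h + u * hs
    have hv' := (mul_eq_zero.mp hv).resolve_left h1
    have hu' := (mul_eq_zero.mp hu).resolve_left h1
    rw [hu', hv'] at e1
    apply h1
    linear_combination (-1 / 3) * e1
  constructor
  · refine mul_left_cancel₀ hJ ?_
    linear_combination v * hs'' - y * h'' - k * v * hs + k * y * h
  · refine mul_left_cancel₀ hJ ?_
    linear_combination x * h'' - u * hs'' - k * x * h + k * u * hs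

/-- Matrices M(m') are cut out by three linear conditions on the entries 00, 11, 01 and 10. Column 0
of N·Sym³g holds the values of the rows of N at the first column of g, and column 1 their
differentials applied to the second. -/
theorem paramMatrix_mul_symCube_iff (m : Fin 13 → ℂ) (g : Matrix (Fin 2) (Fin 2) ℂ) :
    (∃ m', paramMatrix m' = paramMatrix m * symCube g) ↔
      paramMatrix m 0 ⬝ᵥ cubicVec (g 0 0) (g 1 0) = 0 ∧
      cubicDiff (paramMatrix m 1) (g 0 0) (g 1 0) (g 0 1) (g 1 1) = 0 ∧
      cubicDiff (paramMatrix m 0) (g 0 0) (g 1 0) (g 0 1) (g 1 1) +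
        paramMatrix m 1 ⬝ᵥ cubicVec (g 0 0) (g 1 0) = 0 := by
  rw [← mul_symCube_apply_zero, ← mul_symCube_apply_zero, ← mul_symCube_apply_one,
    ← mul_symCube_apply_one]
  constructor
  · rintro ⟨m', h⟩
    rw [← h]
    simp [paramMatrix]
  · rintro ⟨h0, h1, h2⟩
    exact ⟨_, paramMatrix_paramOf h0 h1 h2⟩

/-- The polynomial whose nonvanishing makes the fiber of `ι_tw` through `m` generic. The second
factor is a discriminant and the third one a resultant. -/
def genericValue {R : Type*} [CommRing R] (m : Fin 13 → R) : R :=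
  m 0 * (m 1 ^ 2 - 4 * m 0 * m 2) *
    ((m 0 * m 2 - m 1 ^ 2 + m 0 * m 3) ^ 2 * m 2
      - (m 0 * m 2 - m 1 ^ 2 + m 0 * m 3) * (m 0 * m 4 - m 1 * m 2) * m 1
      + (m 0 * m 4 - m 1 * m 2) ^ 2 * m 0) * (paramMatrix m).det

/-- For generic `m` the first row of `M(m)` has three simple roots, which are not roots of the
second row. -/
theorem exists_three_roots {m : Fin 13 → ℂ} (hm : genericValue m ≠ 0) :
    ∃ a c : Fin 3 → ℂ, (∀ i j k, k ≠ 0 → a i = k * a j → c i = k * c j → i = j) ∧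
      (∀ s t, cubicVec s t ≠ 0 → paramMatrix m 0 ⬝ᵥ cubicVec s t = 0 →
        ∃ i k, k ≠ 0 ∧ s = k * a i ∧ t = k * c i) ∧
      ∀ i, paramMatrix m 0 ⬝ᵥ cubicVec (a i) (c i) = 0 ∧
        paramMatrix m 1 ⬝ᵥ cubicVec (a i) (c i) ≠ 0 ∧
        ∃ b d, cubicDiff (paramMatrix m 0) (a i) (c i) b d ≠ 0 := by
  have hm0 : m 0 ≠ 0 := fun h => hm (by simp [genericValue, h])
  have hdisc : m 1 ^ 2 - 4 * m 0 * m 2 ≠ 0 := fun h => hm (by simp [genericValue, h])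
  have hres : (m 0 * m 2 - m 1 ^ 2 + m 0 * m 3) ^ 2 * m 2
      - (m 0 * m 2 - m 1 ^ 2 + m 0 * m 3) * (m 0 * m 4 - m 1 * m 2) * m 1
      + (m 0 * m 4 - m 1 * m 2) ^ 2 * m 0 ≠ 0 := fun h => hm (by simp [genericValue, h])
  obtain ⟨e, he⟩ := IsAlgClosed.exists_eq_mul_self (m 1 ^ 2 - 4 * m 0 * m 2)
  have he0 : e ≠ 0 := by
    rintro rfl
    exact hdisc (by simpa using he)
  obtain ⟨r, hr⟩ : ∃ r, r = (-m 1 + e) / (2 * m 0) := ⟨_, rfl⟩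
  obtain ⟨r', hr'⟩ : ∃ r', r' = (-m 1 - e) / (2 * m 0) := ⟨_, rfl⟩
  have h1 : m 1 = -m 0 * (r + r') := by
    rw [hr, hr']
    field_simp
    ring
  have h2 : m 2 = m 0 * r * r' := by
    rw [hr, hr']
    field_simp
    linear_combination -he
  have hrr : r ≠ r' := by
    rintro rfl
    apply hdisc
    rw [h1, h2]
    ring
  have hrow0 : ∀ s t, paramMatrix m 0 ⬝ᵥ cubicVec s t =
      m 0 * t * (s - r * t) * (s - r' * t) := by
    intro s t
    simp [paramMatrix, dotProduct, cubicVec, Fin.sum_univ_four]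
    rw [h1, h2]
    ring
  have hrow1 : ∀ x, m 0 * x ^ 2 + m 1 * x + m 2 = 0 →
      paramMatrix m 1 ⬝ᵥ cubicVec x 1 ≠ 0 := by
    intro x hx h
    simp [paramMatrix, dotProduct, cubicVec, Fin.sum_univ_four] at h
    -- The remainder of m₀ times row 1 modulo the quadratic factor of row 0; the third factor of
    -- `genericValue` is the resultant of the two.
    have hlin : (m 0 * m 2 - m 1 ^ 2 + m 0 * m 3) * x + (m 0 * m 4 - m 1 * m 2) = 0 := by
      linear_combination m 0 * h + (m 0 * x - m 1) * hx
    apply hres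
    have hb : m 0 * m 4 - m 1 * m 2 = -(m 0 * m 2 - m 1 ^ 2 + m 0 * m 3) * x := by
      linear_combination hlin
    rw [hb]
    linear_combination (m 0 * m 2 - m 1 ^ 2 + m 0 * m 3) ^ 2 * hx
  -- Row 0 is t(m₀s² + m₁st + m₂t²), with roots (1:0), (r:1) and (r':1).
  refine ⟨![1, r, r'], ![0, 1, 1], ?_, ?_, ?_⟩
  · intro i j k hk ha hc
    fin_cases i <;> fin_cases j <;> simp at ha hc ⊢
    · exact hk hc.symm
    · exact hk hc.symm
    · rw [← hc, one_mul] at ha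
      exact hrr ha
    · rw [← hc, one_mul] at ha
      exact hrr ha.symm
  · intro s t hst h
    rw [hrow0] at h
    rw [Ne, cubicVec_eq_zero_iff, not_and] at hst
    by_cases ht : t = 0
    · exact ⟨0, s, fun hs => hst hs ht, by simp, by simp [ht]⟩
    · have : s - r * t = 0 ∨ s - r' * t = 0 := by simpa [hm0, ht] using h
      rcases this with h | h
      · exact ⟨1, t, ht, by simp; linear_combination h, by simp⟩
      · exact ⟨2, t, ht, by simp; linear_combination h, by simp⟩
  · intro i
    fin_cases i
    · refine ⟨by simp [hrow0], ?_, 0, 1, ?_⟩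
      · simpa [paramMatrix, dotProduct, cubicVec, Fin.sum_univ_four] using hm0
      · simpa [paramMatrix, cubicDiff] using hm0
    · refine ⟨by simp [hrow0], hrow1 r (by rw [h1, h2]; ring), 1, 0, ?_⟩
      have : 2 * m 0 * r + m 1 ≠ 0 := by
        rw [h1]
        intro h
        refine mul_ne_zero hm0 (sub_ne_zero.mpr hrr) ?_
        linear_combination h
      simpa [paramMatrix, cubicDiff] using this
    · refine ⟨by simp [hrow0], hrow1 r' (by rw [h1, h2]; ring), 1, 0, ?_⟩
      have : 2 * m 0 * r' + m 1 ≠ 0 := by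
        rw [h1]
        intro h
        refine mul_ne_zero hm0 (sub_ne_zero.mpr hrr) ?_
        linear_combination -h
      simpa [paramMatrix, cubicDiff] using this

theorem symCube_col_zero (g : Matrix (Fin 2) (Fin 2) ℂ) (i : Fin 4) :
    symCube g i 0 = cubicVec (g 0 0) (g 1 0) i := by
  fin_cases i <;> simp [symCube, cubicVec]

theorem cubicVec_mul (z s t : ℂ) : cubicVec (z * s) (z * t) = z ^ 3 • cubicVec s t := by
  funext i
  fin_cases i <;> simp [cubicVec] <;> ring

/-- The twisted cubic parametrization is injective on points of the projective line. -/
theorem exists_eq_mul_of_cubicVec_eq {s t s' t' : ℂ} (h : cubicVec s t = cubicVec s' t')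
    (h0 : cubicVec s t ≠ 0) : ∃ k, k ≠ 0 ∧ s = k * s' ∧ t = k * t' := by
  have e0 := congrFun h 0
  have e1 := congrFun h 1
  have e3 := congrFun h 3
  simp [cubicVec] at e0 e1 e3
  by_cases hs : s = 0
  · have hs' : s' = 0 := by
      rw [hs] at e0
      simpa using e0.symm
    have ht : t ≠ 0 := fun ht => h0 (cubicVec_eq_zero_iff.mpr ⟨hs, ht⟩)
    have ht' : t' ≠ 0 := by
      rintro rfl
      exact ht (by simpa using e3)
    exact ⟨t / t', div_ne_zero ht ht', by simp [hs, hs'], by field_simp⟩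
  · have hs' : s' ≠ 0 := by
      rintro rfl
      exact hs (by simpa using e0)
    refine ⟨s / s', div_ne_zero hs hs', by field_simp, ?_⟩
    refine mul_left_cancel₀ (pow_ne_zero 2 hs) ?_
    rw [e1]
    field_simp
    linear_combination -t' * e0

/-- For generic `m` there are exactly three points `m'` of projective space such that `M(m')`
and `M(m)` give the same twisted cubic. -/
theorem ncard_fiber {m : Fin 13 → ℂ} (hm : genericValue m ≠ 0) :
    {p : ℙ ℂ (Fin 13 → ℂ) | ∃ g : Matrix (Fin 2) (Fin 2) ℂ, g.det ≠ 0 ∧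
      paramMatrix p.rep = paramMatrix m * symCube g}.ncard = 3 := by
  have hdet : (paramMatrix m).det ≠ 0 := fun h => hm (by simp [genericValue, h])
  obtain ⟨a, c, hinj, hall, hroot⟩ := exists_three_roots hm
  choose b d hbd hb1 hb2 using fun i =>
    exists_second_column (hroot i).1 (hroot i).2.1 (hroot i).2.2
  let g : Fin 3 → Matrix (Fin 2) (Fin 2) ℂ := fun i => !![a i, b i; c i, d i]
  have hg : ∀ i, (g i).det ≠ 0 := fun i => by
    rw [det_fin_two]
    exact hbd i
  choose μ hμ using fun i => (paramMatrix_mul_symCube_iff m (g i)).mpr ⟨(hroot i).1, hb1 i, hb2 i⟩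
  have hμ0 : ∀ i, μ i ≠ 0 := by
    intro i h
    have h1 : (paramMatrix (μ i)).det ≠ 0 := by
      rw [hμ, det_mul]
      exact mul_ne_zero hdet (det_symCube_ne_zero (hg i))
    apply h1
    have : paramMatrix (0 : Fin 13 → ℂ) = 0 := by simpa using paramMatrix_smul 0 (0 : Fin 13 → ℂ)
    rw [h, this, det_zero]
  have hset : {p : ℙ ℂ (Fin 13 → ℂ) | ∃ g : Matrix (Fin 2) (Fin 2) ℂ, g.det ≠ 0 ∧
      paramMatrix p.rep = paramMatrix m * symCube g} =
      Set.range fun i => Projectivization.mk ℂ (μ i) (hμ0 i) := by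
    ext p
    constructor
    · rintro ⟨k, hk, e⟩
      obtain ⟨k0, k1, k2⟩ := (paramMatrix_mul_symCube_iff m k).mp ⟨_, e⟩
      have hcol : cubicVec (k 0 0) (k 1 0) ≠ 0 := by
        rw [Ne, cubicVec_eq_zero_iff]
        rintro ⟨h1, h2⟩
        exact hk (by rw [det_fin_two, h1, h2]; ring)
      obtain ⟨i, z, hz, hs, ht⟩ := hall _ _ hcol k0
      rw [hs, ht] at k1 k2
      obtain ⟨u1, u2⟩ := second_column_unique hz (hroot i).2.1 (hb1 i) (hb2 i) k1 k2
      have hkg : k = z • g i := by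
        ext x y
        fin_cases x <;> fin_cases y <;> simp [g, hs, ht, u1, u2]
      refine ⟨i, ?_⟩
      have hrep : p.rep = z ^ 3 • μ i := by
        apply paramMatrix_injective
        rw [e, hkg, symCube_smul, paramMatrix_smul, hμ, mul_smul_comm]
      rw [← Projectivization.mk_rep p, Projectivization.mk_eq_mk_iff']
      refine ⟨(z ^ 3)⁻¹, ?_⟩
      rw [hrep, smul_smul, inv_mul_cancel₀ (pow_ne_zero 3 hz), one_smul]
    · rintro ⟨i, rfl⟩
      obtain ⟨x, hx⟩ := Projectivization.exists_smul_eq_mk_rep ℂ (μ i) (hμ0 i)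
      -- Scaling g by z scales Sym³g by z³, so a cube root absorbs the choice of representative.
      obtain ⟨z, hz⟩ := exists_pow_three_eq (x : ℂ)
      have hz0 : z ≠ 0 := by
        rintro rfl
        exact x.ne_zero (by simp [← hz])
      refine ⟨z • g i, ?_, ?_⟩
      · rw [det_smul]
        exact mul_ne_zero (pow_ne_zero _ hz0) (hg i)
      · rw [← hx, Units.smul_def, ← hz, paramMatrix_smul, symCube_smul, hμ, mul_smul_comm]
  rw [hset, ← Set.image_univ, Set.ncard_image_of_injective]
  · rw [Set.ncard_univ, Nat.card_eq_fintype_card, Fintype.card_fin]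
  intro i j hij
  obtain ⟨x, hx⟩ := (Projectivization.mk_eq_mk_iff' ℂ _ _ (hμ0 i) (hμ0 j)).mp hij
  have hx0 : x ≠ 0 := by
    rintro rfl
    exact hμ0 i (by rw [← hx, zero_smul])
  obtain ⟨z, hz⟩ := exists_pow_three_eq x
  have hS : symCube (g i) = x • symCube (g j) := by
    have h1 : paramMatrix m * symCube (g i) = paramMatrix m * (x • symCube (g j)) := by
      rw [← hμ, ← hx, paramMatrix_smul, hμ, mul_smul_comm]
    have h2 := congrArg (fun N => (paramMatrix m)⁻¹ * N) h1
    simpa [← mul_assoc, nonsing_inv_mul _ hdet.isUnit] using h2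
  have hcol : cubicVec (a i) (c i) = x • cubicVec (a j) (c j) := by
    funext l
    have := congrFun (congrFun hS l) 0
    rw [Matrix.smul_apply, symCube_col_zero, symCube_col_zero] at this
    exact this
  rw [← hz, ← cubicVec_mul] at hcol
  obtain ⟨k, hk, h1, h2⟩ := exists_eq_mul_of_cubicVec_eq hcol (fun h => by
    rw [cubicVec_eq_zero_iff] at h
    exact hbd i (by rw [h.1, h.2]; ring))
  have hz0 : z ≠ 0 := by
    rintro rfl
    exact hx0 (by simp [← hz])
  exact hinj i j (k * z) (mul_ne_zero hk hz0) (by rw [h1, mul_assoc]) (by rw [h2, mul_assoc])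

end Fiber

/-! ### Degree six and the absence of a common factor. -/

section Degree

/-- For fixed x both sides are polynomials in c; comparing coefficients kills every homogeneous
component of degree other than k. -/
theorem isHomogeneous_of_eval_const_mul {ι : Type*} {p : MvPolynomial ι ℂ} {k : ℕ}
    (h : ∀ (c : ℂ) (x : ι → ℂ), eval (fun j => c * x j) p = c ^ k * eval x p) :
    p.IsHomogeneous k := by
  have hcomp : ∀ i, i ≠ k → homogeneousComponent i p = 0 := by
    intro i hik
    refine MvPolynomial.funext fun x => ?_
    have hpoly : ∑ i ∈ Finset.range (p.totalDegree + 1),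
        Polynomial.monomial i (eval x (homogeneousComponent i p)) =
        Polynomial.monomial k (eval x p) := by
      refine Polynomial.funext fun c => ?_
      rw [Polynomial.eval_monomial, mul_comm, ← h, eval_const_mul_eq_sum]
      simp [Polynomial.eval_finsetSum, mul_comm]
    have h1 := congrArg (fun q => Polynomial.coeff q i) hpoly
    simp only [Polynomial.finsetSum_coeff, Polynomial.coeff_monomial, Finset.sum_ite_eq',
      Finset.mem_range, if_neg (Ne.symm hik)] at h1
    rw [map_zero]
    split_ifs at h1 with hlt
    · exact h1
    · rw [homogeneousComponent_eq_zero _ _ (by omega), map_zero]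
  have hp : p = homogeneousComponent k p := by
    conv_lhs => rw [← sum_homogeneousComponent p]
    by_cases hk : k ∈ Finset.range (p.totalDegree + 1)
    · exact Finset.sum_eq_single_of_mem k hk fun i _ hik => hcomp i hik
    · rw [homogeneousComponent_eq_zero k p (by simpa using hk)]
      exact Finset.sum_eq_zero fun i hi => hcomp i fun e => hk (e ▸ hi)
  rw [hp]
  exact homogeneousComponent_isHomogeneous k p

theorem wedgeTwo_smul {R : Type*} [CommRing R] (c : R) (M : Matrix (Fin 4) (Fin 4) R) :
    wedgeTwo (c • M) = c ^ 2 • wedgeTwo M := by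
  ext k l
  simp only [wedgeTwo, Matrix.smul_apply, smul_eq_mul]
  ring

theorem iotaVec_smul (c : ℂ) (m : Fin 13 → ℂ) : iotaVec (c • m) = c ^ 6 • iotaVec m := by
  refine dotProduct_veronese_injective fun L => ?_
  have h : coWedgeTwo (paramMatrix (c • m)) = c ^ 2 • coWedgeTwo (paramMatrix m) := by
    rw [paramMatrix_smul, coWedgeTwo, coWedgeTwo, transpose_smul, wedgeTwo_smul, mul_smul_comm,
      smul_mul_assoc]
  rw [smul_dotProduct, iotaVec_dotProduct_veronese, iotaVec_dotProduct_veronese, h, smul_mulVec,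
    omegaEval_smul, smul_eq_mul]
  ring

theorem isHomogeneous_iotaForms (s : Sym (Fin 6) 3) : (iotaForms s).IsHomogeneous 6 := by
  refine isHomogeneous_of_eval_const_mul fun c x => ?_
  rw [eval_iotaForms, eval_iotaForms]
  exact congrFun (iotaVec_smul c x) s

variable {R : Type*} [CommRing R]

theorem coWedgeTwo_mulVec_single_five (M : Matrix (Fin 4) (Fin 4) R) :
    coWedgeTwo M *ᵥ Pi.single 5 1 = sigmaMat *ᵥ plucker (M 0) (M 1) := by
  have e : (sigmaMat *ᵥ Pi.single 5 1 : Fin 6 → R) = Pi.single 0 1 := by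
    rw [sigmaMat_mulVec]
    funext k
    fin_cases k <;> simp
  rw [coWedgeTwo, ← mulVec_mulVec, ← mulVec_mulVec, e, wedgeTwo_mulVec_single]
  rfl

theorem coWedgeTwo_mulVec_single_zero (M : Matrix (Fin 4) (Fin 4) R) :
    coWedgeTwo M *ᵥ Pi.single 0 1 = sigmaMat *ᵥ plucker (M 2) (M 3) := by
  have e : (sigmaMat *ᵥ Pi.single 0 1 : Fin 6 → R) = Pi.single 5 1 := by
    rw [sigmaMat_mulVec]
    funext k
    fin_cases k <;> simp
  rw [coWedgeTwo, ← mulVec_mulVec, ← mulVec_mulVec, e, wedgeTwo_mulVec_single]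
  rfl

theorem map_omegaEval_sigmaMat_plucker {S : Type*} [CommRing S] (φ : R →+* S) (f g : Fin 4 → R) :
    φ (omegaEval (sigmaMat *ᵥ plucker f g)) =
      omegaEval (sigmaMat *ᵥ plucker (fun i => φ (f i)) fun i => φ (g i)) := by
  rw [sigmaMat_mulVec, sigmaMat_mulVec]
  simp [omegaEval, plucker, map_ofNat]

/-- The resultant of two binary cubic forms with coefficients in a subalgebra lies in it. -/
theorem omegaEval_sigmaMat_plucker_mem {A : Type*} [CommRing A] [Algebra R A]
    (S : Subalgebra R A) {f g : Fin 4 → A} (hf : ∀ i, f i ∈ S) (hg : ∀ i, g i ∈ S) :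
    omegaEval (sigmaMat *ᵥ plucker f g) ∈ S := by
  have := map_omegaEval_sigmaMat_plucker S.val.toRingHom (fun i => (⟨f i, hf i⟩ : S))
    fun i => (⟨g i, hg i⟩ : S)
  exact this ▸ Subtype.property _

/-- Over a domain the degree in each variable is additive on products. -/
theorem degreeOf_eq_zero_of_dvd_of_mem_supported {ι : Type*} {g p : MvPolynomial ι ℂ} (hp : p ≠ 0)
    (hgp : g ∣ p) {s : Set ι} (hps : p ∈ supported ℂ s) {i : ι} (hi : i ∉ s) :
    degreeOf i g = 0 := by
  obtain ⟨q, rfl⟩ := hgp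
  have h0 : degreeOf i (g * q) = 0 := by
    by_contra h
    exact hi (mem_supported.mp hps (mem_vars_iff_degreeOf_ne_zero.mpr h))
  rw [degreeOf_mul_eq (left_ne_zero_of_mul hp) (right_ne_zero_of_mul hp)] at h0
  omega

theorem isUnit_of_forall_dvd_iotaForms {g : MvPolynomial (Fin 13) ℂ} (h : ∀ j, g ∣ iotaForms j) :
    IsUnit g := by
  -- A common factor divides every value of the cubic. At the coordinate vectors 5 and 0 these
  -- values are the resultants of rows 0, 1 and of rows 2, 3, in m₀,…,m₄ and in m₅,…,m₁₂.
  have hL : ∀ L : Fin 6 → MvPolynomial (Fin 13) ℂ,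
      g ∣ omegaEval (coWedgeTwo (paramMatrix X) *ᵥ L) := by
    intro L
    rw [← iotaVec_dotProduct_veronese]
    exact Finset.dvd_sum fun j _ => Dvd.dvd.mul_right (h j) _
  have h5 := hL (Pi.single 5 1)
  have h0 := hL (Pi.single 0 1)
  rw [coWedgeTwo_mulVec_single_five] at h5
  rw [coWedgeTwo_mulVec_single_zero] at h0
  have n5 : omegaEval (sigmaMat *ᵥ plucker (paramMatrix (X : Fin 13 → MvPolynomial (Fin 13) ℂ) 0)
      (paramMatrix X 1)) ≠ 0 := by
    intro e
    -- Here the rows are s²t and t³ − s³, which have no common root.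
    have := congrArg (eval (![1, 0, 0, 0, 1, 0, 0, 0, 0, 0, 0, 0, 0] : Fin 13 → ℂ)) e
    rw [map_omegaEval_sigmaMat_plucker, sigmaMat_mulVec] at this
    simp [paramMatrix, omegaEval, plucker, pair] at this
  have n0 : omegaEval (sigmaMat *ᵥ plucker (paramMatrix (X : Fin 13 → MvPolynomial (Fin 13) ℂ) 2)
      (paramMatrix X 3)) ≠ 0 := by
    intro e
    have := congrArg (eval (![0, 0, 0, 0, 0, 1, 0, 0, 0, 0, 0, 0, 1] : Fin 13 → ℂ)) e
    rw [map_omegaEval_sigmaMat_plucker, sigmaMat_mulVec] at this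
    simp [paramMatrix, omegaEval, plucker, pair] at this
  have s5 := omegaEval_sigmaMat_plucker_mem (supported ℂ {i : Fin 13 | i < 5})
    (f := paramMatrix X 0) (g := paramMatrix X 1)
    (by
      intro i
      fin_cases i <;> simp [paramMatrix, X_mem_supported])
    (by
      intro i
      fin_cases i <;> simp [paramMatrix, X_mem_supported])
  have s0 := omegaEval_sigmaMat_plucker_mem (supported ℂ {i : Fin 13 | 5 ≤ i})
    (f := paramMatrix X 2) (g := paramMatrix X 3)
    (by
      intro i
      fin_cases i <;> simp [paramMatrix, X_mem_supported])
    (by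
      intro i
      fin_cases i <;> simp [paramMatrix, X_mem_supported])
  have hvars : g.vars = ∅ := by
    rw [Finset.eq_empty_iff_forall_notMem]
    intro i
    rw [mem_vars_iff_degreeOf_ne_zero, not_not]
    by_cases hi : i < 5
    · exact degreeOf_eq_zero_of_dvd_of_mem_supported n0 h0 s0 (by simpa using hi)
    · exact degreeOf_eq_zero_of_dvd_of_mem_supported n5 h5 s5 hi
  have hg0 : g ≠ 0 := by
    rintro rfl
    exact n5 (zero_dvd_iff.mp h5)
  obtain ⟨c, rfl⟩ : ∃ c, g = C c := by
    have : g ∈ supported ℂ (∅ : Set (Fin 13)) := by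
      rw [mem_supported, hvars]
      simp
    rw [supported_empty] at this
    obtain ⟨c, hc⟩ := Algebra.mem_bot.mp this
    exact ⟨c, hc.symm⟩
  refine (IsUnit.mk0 c ?_).map C
  rintro rfl
  exact hg0 (map_zero C)

theorem hasDegree_iotaForms : HasDegree iotaForms 6 :=
  ⟨isHomogeneous_iotaForms, fun _ h => isUnit_of_forall_dvd_iotaForms h⟩

end Degree

/-! ### Dominance: the image and the set of Chow forms satisfy the same forms. -/

section Closure

/-- The vector `ν_3(Σ ∧²(Aᵀ) Σ)ᵀ ω^tw`, for an arbitrary `4 × 4` matrix `A`. -/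
noncomputable def coVec {R : Type*} [CommRing R] (A : Matrix (Fin 4) (Fin 4) R) :
    Sym (Fin 6) 3 → R :=
  (veroneseMatrix 3 (coWedgeTwo A))ᵀ *ᵥ omegaTw

theorem coVec_map {R S : Type*} [CommRing R] [CommRing S] (f : R →+* S)
    (A : Matrix (Fin 4) (Fin 4) R) (s : Sym (Fin 6) 3) : f (coVec A s) = coVec (A.map f) s := by
  have h1 : coWedgeTwo (A.map f) = (coWedgeTwo A).map f := by
    ext k l
    rw [coWedgeTwo_apply, Matrix.map_apply, coWedgeTwo_apply]
    fin_cases k <;> fin_cases l <;> simp [wedgeTwo]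
  simp only [coVec, h1, veroneseMatrix_map]
  simp [mulVec, dotProduct, omegaTw_map]

theorem coVec_eq_smul {A : Matrix (Fin 4) (Fin 4) ℂ} (hA : A.det ≠ 0) :
    coVec A = A.det ^ 3 • chowFormTw A := by
  refine dotProduct_veronese_injective fun L => ?_
  rw [coVec, transpose_veroneseMatrix_dotProduct, omegaTw_dotProduct_veronese, smul_dotProduct,
    chowFormTw_dotProduct_veronese]
  change omegaEval (coWedgeTwo A *ᵥ L) = _
  rw [coWedgeTwo_eq_smul hA, smul_mulVec, omegaEval_smul, smul_eq_mul]

theorem eval_smul_eq_zero_iff {ι : Type*} {f : MvPolynomial ι ℂ} {k : ℕ} (hf : f.IsHomogeneous k)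
    {c : ℂ} (hc : c ≠ 0) (y : ι → ℂ) : eval (c • y) f = 0 ↔ eval y f = 0 := by
  change eval (fun j => c * y j) f = 0 ↔ _
  rw [eval_const_mul hf, mul_eq_zero, or_iff_right (pow_ne_zero k hc)]

theorem eval_rep_mk_eq_zero_iff {ι : Type*} {f : MvPolynomial ι ℂ} {k : ℕ}
    (hf : f.IsHomogeneous k) {v : ι → ℂ} (hv : v ≠ 0) :
    eval (Projectivization.mk ℂ v hv).rep f = 0 ↔ eval v f = 0 := by
  obtain ⟨c, hc⟩ := Projectivization.exists_smul_eq_mk_rep ℂ v hv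
  rw [← hc, Units.smul_def, eval_smul_eq_zero_iff hf c.ne_zero]

theorem mem_iotaTw_iff {p : ℙ ℂ (Fin 13 → ℂ)} {q : ℙ ℂ (Sym (Fin 6) 3 → ℂ)} :
    q ∈ iotaTw p ↔ ∃ h : iotaVec p.rep ≠ 0, Projectivization.mk ℂ _ h = q := by
  have e : (fun j => eval p.rep (iotaForms j)) = iotaVec p.rep := by
    funext j
    exact eval_iotaForms p.rep j
  rw [← e]
  rfl

/-- A form that vanishes on the Chow forms of the cubics `M(m) · C` vanishes on all Chow forms of
twisted cubics. -/
theorem eval_chowFormTw_eq_zero {f : MvPolynomial (Sym (Fin 6) 3) ℂ} {k : ℕ}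
    (hf : f.IsHomogeneous k)
    (h : ∀ m, (paramMatrix m).det ≠ 0 → eval (chowFormTw (paramMatrix m)) f = 0)
    {A : Matrix (Fin 4) (Fin 4) ℂ} (hA : A.det ≠ 0) : eval (chowFormTw A) f = 0 := by
  have hmul : ∀ {A : Matrix (Fin 4) (Fin 4) ℂ} {g : Matrix (Fin 2) (Fin 2) ℂ}, A.det ≠ 0 →
      g.det ≠ 0 → (eval (chowFormTw (A * symCube g)) f = 0 ↔ eval (chowFormTw A) f = 0) := by
    intro A g hA hg
    rw [chowFormTw_mul_symCube hA hg, eval_smul_eq_zero_iff hf]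
    rw [det_nonsing_inv]
    exact pow_ne_zero _ hg.isUnit.ringInverse.ne_zero
  have hco : ∀ {A : Matrix (Fin 4) (Fin 4) ℂ}, A.det ≠ 0 →
      (eval (coVec A) f = 0 ↔ eval (chowFormTw A) f = 0) := by
    intro A hA
    rw [coVec_eq_smul hA, eval_smul_eq_zero_iff hf (pow_ne_zero _ hA)]
  -- The root (1:0) of row 0 is kept as the first column of g, and the second column normalizes A to
  -- the shape M(m).
  have hgen : ∀ A : Matrix (Fin 4) (Fin 4) ℂ, A.det ≠ 0 → A 0 0 = 0 → A 1 0 ≠ 0 → A 0 1 ≠ 0 →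
      eval (chowFormTw A) f = 0 := by
    intro A hA h00 h10 h01
    obtain ⟨b, d, hg, h1, h2⟩ := exists_second_column (f₀ := A 0) (f₁ := A 1) (a := 1) (c := 0)
      (by simpa [dotProduct, cubicVec, Fin.sum_univ_four] using h00)
      (by simpa [dotProduct, cubicVec, Fin.sum_univ_four] using h10)
      ⟨0, 1, by simpa [cubicDiff] using h01⟩
    have hg' : (!![1, b; 0, d] : Matrix (Fin 2) (Fin 2) ℂ).det ≠ 0 := by
      rw [det_fin_two]
      exact hg
    rw [← hmul hA hg']
    have e : paramMatrix (paramOf (A * symCube !![1, b; 0, d])) = A * symCube !![1, b; 0, d] := by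
      refine paramMatrix_paramOf ?_ ?_ ?_
      · rw [mul_symCube_apply_zero]
        simpa [dotProduct, cubicVec, Fin.sum_univ_four] using h00
      · rw [mul_symCube_apply_one]
        exact h1
      · rw [mul_symCube_apply_zero, mul_symCube_apply_one]
        exact h2
    rw [← e]
    refine h _ ?_
    rw [e, det_mul]
    exact mul_ne_zero hA (det_symCube_ne_zero hg')
  have hvertex : ∀ A : Matrix (Fin 4) (Fin 4) ℂ, A.det ≠ 0 → A 0 0 = 0 →
      eval (chowFormTw A) f = 0 := by
    -- The conditions det ≠ 0, A₁₀ ≠ 0, A₀₁ ≠ 0 are dense among matrices with A₀₀ = 0: on the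
    -- generic such matrix f times their product is zero, so f is zero.
    let N : Matrix (Fin 4) (Fin 4) (MvPolynomial (Fin 4 × Fin 4) ℂ) :=
      of fun i j => if i = 0 ∧ j = 0 then 0 else X (i, j)
    have hN : ∀ x : Fin 4 × Fin 4 → ℂ, N.map (eval x) =
        of fun i j => if i = 0 ∧ j = 0 then 0 else x (i, j) := by
      intro x
      ext i j
      by_cases hij : i = 0 ∧ j = 0 <;> simp [N, hij]
    have hdet : ∀ x, eval x N.det = (N.map (eval x)).det := fun x => RingHom.map_det _ _
    have hev : ∀ x, eval x (aeval (coVec N) f) = eval (coVec (N.map (eval x))) f := by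
      intro x
      have e : (fun j => eval x (coVec N j)) = coVec (N.map (eval x)) := by
        funext j
        exact coVec_map (eval x) N j
      rw [eval_aeval, e]
    have hprod : aeval (coVec N) f * (N.det * (X (1, 0) * X (0, 1))) = 0 := by
      refine MvPolynomial.funext fun x => ?_
      rw [map_zero, map_mul, map_mul, map_mul, hev, hdet, eval_X, eval_X]
      by_contra hne
      have hd := left_ne_zero_of_mul (right_ne_zero_of_mul hne)
      have hx := right_ne_zero_of_mul (right_ne_zero_of_mul hne)
      refine left_ne_zero_of_mul hne ((hco hd).mpr (hgen _ hd ?_ ?_ ?_)) <;> rw [hN]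
      · simp
      · simpa using left_ne_zero_of_mul hx
      · simpa using right_ne_zero_of_mul hx
    have hdN : N.det ≠ 0 := by
      intro h0
      have h1 := congrArg (eval fun ij : Fin 4 × Fin 4 =>
        (!![0, 1, 0, 0; 1, 0, 0, 0; 0, 0, 1, 0; 0, 0, 0, 1] : Matrix (Fin 4) (Fin 4) ℂ)
          ij.1 ij.2) h0
      rw [hdet, hN, det_fin_four] at h1
      simp [wedgeTwo, pair] at h1
    have hz : aeval (coVec N) f = 0 :=
      (mul_eq_zero.mp hprod).resolve_right
        (mul_ne_zero hdN (mul_ne_zero (X_ne_zero _) (X_ne_zero _)))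
    intro A hA h00
    have hAN : N.map (eval fun ij : Fin 4 × Fin 4 => A ij.1 ij.2) = A := by
      rw [hN]
      ext i j
      by_cases hij : i = 0 ∧ j = 0
      · simp [hij, h00]
      · simp [hij]
    rw [← hco hA, ← hAN, ← hev, hz, map_zero]
  have hrow : A 0 ≠ 0 := fun h2 => hA (det_eq_zero_of_row_eq_zero 0 fun j => congrFun h2 j)
  -- Taking the second cubic to be zero, this just provides a root of row 0; a change of coordinates
  -- then moves it to (1:0).
  obtain ⟨s, t, hst, h0, -⟩ := exists_common_root (g := 0) hrow (by
    rw [sigmaMat_mulVec]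
    simp [omegaEval, plucker])
  obtain ⟨b, d, hg⟩ : ∃ b d, (!![s, b; t, d] : Matrix (Fin 2) (Fin 2) ℂ).det ≠ 0 := by
    by_cases hs : s = 0
    · refine ⟨1, 0, ?_⟩
      rw [Ne, cubicVec_eq_zero_iff, not_and] at hst
      simpa [det_fin_two] using hst hs
    · exact ⟨0, 1, by simpa [det_fin_two] using hs⟩
  rw [← hmul hA hg]
  refine hvertex _ ?_ ?_
  · rw [det_mul]
    exact mul_ne_zero hA (det_symCube_ne_zero hg)
  · rw [mul_symCube_apply_zero]
    exact h0

theorem det_paramMatrix_X_ne_zero :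
    (paramMatrix (X : Fin 13 → MvPolynomial (Fin 13) ℂ)).det ≠ 0 := by
  intro h
  have h1 := congrArg (eval (![1, 0, 0, 0, 0, 0, 0, 1, 0, 0, 0, 0, 1] : Fin 13 → ℂ)) h
  rw [det_fin_four] at h1
  simp [wedgeTwo, pair, paramMatrix] at h1

theorem eval_det_paramMatrix (m : Fin 13 → ℂ) :
    eval m (paramMatrix X).det = (paramMatrix m).det := by
  rw [det_fin_four, det_fin_four]
  simp [wedgeTwo, pair, paramMatrix]

/-- Density of det M(m) ≠ 0: the product of the pulled-back polynomial with det M is identically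
zero, and the polynomial ring is a domain. -/
theorem eval_iotaVec_eq_zero {f : MvPolynomial (Sym (Fin 6) 3) ℂ}
    (h : ∀ m, (paramMatrix m).det ≠ 0 → eval (iotaVec m) f = 0) (m : Fin 13 → ℂ) :
    eval (iotaVec m) f = 0 := by
  have hev : ∀ x, eval x (aeval iotaForms f) = eval (iotaVec x) f := by
    intro x
    rw [eval_aeval]
    simp only [eval_iotaForms]
  have hprod : aeval iotaForms f * (paramMatrix X).det = 0 := by
    refine MvPolynomial.funext fun x => ?_
    rw [map_zero, map_mul, hev, eval_det_paramMatrix]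
    by_contra hne
    exact left_ne_zero_of_mul hne (h x (right_ne_zero_of_mul hne))
  rw [← hev, (mul_eq_zero.mp hprod).resolve_right det_paramMatrix_X_ne_zero, map_zero]

theorem forall_ran_iotaTw_iff {f : MvPolynomial (Sym (Fin 6) 3) ℂ} {k : ℕ}
    (hf : f.IsHomogeneous k) :
    (∀ q ∈ iotaTw.ran, eval q.rep f = 0) ↔ ∀ m, eval (iotaVec m) f = 0 := by
  constructor
  · intro h
    refine eval_iotaVec_eq_zero fun m hm => ?_
    have hm0 : m ≠ 0 := by
      rintro rfl
      apply hm
      have : paramMatrix (0 : Fin 13 → ℂ) = 0 := by simpa using paramMatrix_smul 0 (0 : Fin 13 → ℂ)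
      rw [this, det_zero]
    obtain ⟨c, hc⟩ := Projectivization.exists_smul_eq_mk_rep ℂ m hm0
    have hi : iotaVec (Projectivization.mk ℂ m hm0).rep = (c : ℂ) ^ 6 • iotaVec m := by
      rw [← hc, Units.smul_def, iotaVec_smul]
    have hc6 : (c : ℂ) ^ 6 ≠ 0 := pow_ne_zero _ c.ne_zero
    have hne : iotaVec (Projectivization.mk ℂ m hm0).rep ≠ 0 := by
      rw [hi, iotaVec_eq_smul hm]
      exact smul_ne_zero hc6 (smul_ne_zero (pow_ne_zero _ hm) (chowFormTw_ne_zero hm))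
    have := h _ ⟨_, mem_iotaTw_iff.mpr ⟨hne, rfl⟩⟩
    rwa [eval_rep_mk_eq_zero_iff hf, hi, eval_smul_eq_zero_iff hf hc6] at this
  · rintro h q ⟨p, hp⟩
    obtain ⟨hne, rfl⟩ := mem_iotaTw_iff.mp hp
    rw [eval_rep_mk_eq_zero_iff hf]
    exact h _

theorem zariskiClosure_ran_iotaTw : zariskiClosure iotaTw.ran = chTw := by
  have key : ∀ (f : MvPolynomial (Sym (Fin 6) 3) ℂ) (k : ℕ), f.IsHomogeneous k →
      ((∀ q ∈ iotaTw.ran, eval q.rep f = 0) ↔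
        ∀ q ∈ {q | ∃ (A : Matrix (Fin 4) (Fin 4) ℂ) (_ : A.det ≠ 0) (h : chowFormTw A ≠ 0),
          q = Projectivization.mk ℂ _ h}, eval q.rep f = 0) := by
    intro f k hf
    rw [forall_ran_iotaTw_iff hf]
    constructor
    · rintro h q ⟨A, hA, hne, rfl⟩
      rw [eval_rep_mk_eq_zero_iff hf]
      refine eval_chowFormTw_eq_zero hf (fun m hm => ?_) hA
      have := h m
      rwa [iotaVec_eq_smul hm, eval_smul_eq_zero_iff hf (pow_ne_zero _ hm)] at this
    · intro h
      refine eval_iotaVec_eq_zero fun m hm => ?_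
      rw [iotaVec_eq_smul hm, eval_smul_eq_zero_iff hf (pow_ne_zero _ hm)]
      have := h _ ⟨_, hm, chowFormTw_ne_zero hm, rfl⟩
      rwa [eval_rep_mk_eq_zero_iff hf] at this
  ext p
  exact forall_congr' fun f => forall_congr' fun k => forall_congr' fun hf =>
    imp_congr (key f k hf) Iff.rfl

end Closure

/-! ### Generic fibers over the source and over the target. -/

section Generic

theorem eval_genericValue (m : Fin 13 → ℂ) : eval m (genericValue X) = genericValue m := by
  rw [genericValue, map_mul, eval_det_paramMatrix]
  simp [genericValue]

theorem isHomogeneous_genericValue :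
    (genericValue X : MvPolynomial (Fin 13) ℂ).IsHomogeneous 12 := by
  refine isHomogeneous_of_eval_const_mul fun c x => ?_
  rw [eval_genericValue, eval_genericValue, genericValue, genericValue]
  change _ * (paramMatrix (c • x)).det = _
  rw [paramMatrix_smul, det_smul, Fintype.card_fin]
  ring

theorem genericValue_X_ne_zero : (genericValue X : MvPolynomial (Fin 13) ℂ) ≠ 0 := by
  intro h
  have h1 := congrArg (eval (![1, 0, -1, 1, 1, 0, 0, 1, 0, 0, 0, 0, 1] : Fin 13 → ℂ)) h
  rw [eval_genericValue, genericValue, det_fin_four] at h1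
  simp [wedgeTwo, pair, paramMatrix] at h1

theorem det_ne_zero_of_genericValue_ne_zero {m : Fin 13 → ℂ} (hm : genericValue m ≠ 0) :
    (paramMatrix m).det ≠ 0 := fun h => hm (by simp [genericValue, h])

theorem iotaVec_ne_zero {m : Fin 13 → ℂ} (hm : (paramMatrix m).det ≠ 0) : iotaVec m ≠ 0 := by
  rw [iotaVec_eq_smul hm]
  exact smul_ne_zero (pow_ne_zero _ hm) (chowFormTw_ne_zero hm)

theorem ncard_fiber_iotaTw {m : Fin 13 → ℂ} (hm : genericValue m ≠ 0) (hne : iotaVec m ≠ 0) :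
    {p | Projectivization.mk ℂ (iotaVec m) hne ∈ iotaTw p}.ncard = 3 := by
  refine (congrArg Set.ncard ?_).trans (ncard_fiber hm)
  ext p
  rw [Set.mem_ofPred_eq, Set.mem_ofPred_eq,
    ← exists_smul_iotaVec_iff (det_ne_zero_of_genericValue_ne_zero hm), mem_iotaTw_iff]
  constructor
  · rintro ⟨h, e⟩
    obtain ⟨c, hc⟩ := (Projectivization.mk_eq_mk_iff' ℂ _ _ h hne).mp e
    refine ⟨c, ?_, hc.symm⟩
    rintro rfl
    exact h (by rw [← hc, zero_smul])
  · rintro ⟨c, hc, e⟩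
    have h : iotaVec p.rep ≠ 0 := by
      rw [e]
      exact smul_ne_zero hc hne
    exact ⟨h, (Projectivization.mk_eq_mk_iff' ℂ _ _ h hne).mpr ⟨c, e.symm⟩⟩

theorem genericallyToOneOnSource_iotaTw : GenericallyToOneOnSource iotaTw 3 := by
  refine ⟨genericValue X, 12, isHomogeneous_genericValue, genericValue_X_ne_zero, fun p hp => ?_⟩
  rw [eval_genericValue] at hp
  have hne := iotaVec_ne_zero (det_ne_zero_of_genericValue_ne_zero hp)
  exact ⟨_, mem_iotaTw_iff.mpr ⟨hne, rfl⟩, ncard_fiber_iotaTw hp hne⟩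

theorem genericallyToOneOver_iotaTw : GenericallyToOneOver iotaTw chTw 3 := by
  obtain ⟨g, k, hg, ⟨x, hx⟩, H⟩ := exists_isHomogeneous_forall_exists_eval_eq (by norm_num)
    isHomogeneous_iotaForms genericValue_X_ne_zero
  simp only [eval_iotaForms, eval_genericValue] at hx H
  refine ⟨g, k, hg, ?_, ?_⟩
  · obtain ⟨m, hm, hgm⟩ : ∃ m, (paramMatrix m).det ≠ 0 ∧ eval (iotaVec m) g ≠ 0 := by
      by_contra! hc
      exact hx (eval_iotaVec_eq_zero hc x)
    refine ⟨Projectivization.mk ℂ _ (chowFormTw_ne_zero hm), ?_, ?_⟩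
    · exact fun f _ _ h => h _ ⟨_, hm, chowFormTw_ne_zero hm, rfl⟩
    · rw [Ne, eval_rep_mk_eq_zero_iff hg]
      rwa [iotaVec_eq_smul hm, Ne, eval_smul_eq_zero_iff hg (pow_ne_zero _ hm)] at hgm
  · intro q hq hgq
    rw [← zariskiClosure_ran_iotaTw] at hq
    -- Such a q is the image of some m with `genericValue m` ≠ 0, so its fiber is the fiber through
    -- m, already counted.
    obtain ⟨m, c, hc, hm, hmq⟩ := H q.rep
      (fun f i hf h => hq f i hf ((forall_ran_iotaTw_iff hf).mpr h)) hgq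
    have hne := iotaVec_ne_zero (det_ne_zero_of_genericValue_ne_zero hm)
    have e : Projectivization.mk ℂ (iotaVec m) hne = q := by
      rw [← Projectivization.mk_rep q, Projectivization.mk_eq_mk_iff']
      exact ⟨c, funext fun j => (hmq j).symm⟩
    rw [← e]
    exact ncard_fiber_iotaTw hm hne

theorem mk_chowFormTw_mem_iotaTw {p : ℙ ℂ (Fin 13 → ℂ)} (hp : (paramMatrix p.rep).det ≠ 0) :
    Projectivization.mk ℂ _ (chowFormTw_ne_zero hp) ∈ iotaTw p := by
  refine mem_iotaTw_iff.mpr ⟨iotaVec_ne_zero hp, ?_⟩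
  rw [Projectivization.mk_eq_mk_iff']
  exact ⟨_, (iotaVec_eq_smul hp).symm⟩

end Generic

end TwistedCubic

theorem mainTheorem4 :
    -- the vectors used to define `Ch_tw` are Chow forms of the twisted cubics
    (∀ A : Matrix (Fin 4) (Fin 4) ℂ, A.det ≠ 0 →
      TwistedCubic.IsChowForm (TwistedCubic.twistedCubic A) (TwistedCubic.chowFormTw A)) ∧
    -- `ι_tw` sends `m` to the Chow form of the twisted cubic given by `M(m)`
    (∀ p : ℙ ℂ (Fin 13 → ℂ), (TwistedCubic.paramMatrix p.rep).det ≠ 0 →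
      ∃ h : TwistedCubic.chowFormTw (TwistedCubic.paramMatrix p.rep) ≠ 0,
        Projectivization.mk ℂ _ h ∈ TwistedCubic.iotaTw p) ∧
    -- degree 6
    TwistedCubic.HasDegree TwistedCubic.iotaForms 6 ∧
    -- generically 3-to-1
    TwistedCubic.GenericallyToOneOnSource TwistedCubic.iotaTw 3 ∧
    TwistedCubic.GenericallyToOneOver TwistedCubic.iotaTw TwistedCubic.chTw 3 ∧
    -- dominant
    TwistedCubic.zariskiClosure TwistedCubic.iotaTw.ran = TwistedCubic.chTw := by
  exact ⟨fun _ hA => TwistedCubic.isChowForm_chowFormTw hA,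
    fun _ hp => ⟨TwistedCubic.chowFormTw_ne_zero hp, TwistedCubic.mk_chowFormTw_mem_iotaTw hp⟩,
    TwistedCubic.hasDegree_iotaForms, TwistedCubic.genericallyToOneOnSource_iotaTw,
    TwistedCubic.genericallyToOneOver_iotaTw, TwistedCubic.zariskiClosure_ran_iotaTw⟩
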